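/- **Setting.** Let $\mathcal Y\subset\mathbb R^n$ be compact, $X\subseteq\mathbb R^d$, and for $x\in X$ consider $$\min_{y\in\mathcal Y} f(x,y)\quad\text{s.t. } g_j(x,y)\le 0\ (1\le j\le p),\quad h_i(x,y)=0\ (1\le i\le q),$$ with feasible region $Y(x)=\{y\in\mathcal Y: g(x,y)\le 0,\ h(x,y)=0\}$. Assume that for every $x\in X$: $Y(x)$ is nonempty, compact and contained in the interior of $\mathcal Y$; $f(x,\cdot),g_j(x,\cdot),h_i(x,\cdot)$ are $C^1$ on $\mathcal Y$; and at every $y\in Y(x)$ MFCQ or LICQ holds. A triple $(y,\mu,\lambda)$ is a *KKT triple* if $y\in Y(x)$, $\mu\ge 0$, $\mu_jg_j(x,y)=0$ for all $j$, and $\nabla_yf(x,y)+\sum_j\mu_j\nabla_yg_j(x,y)+\sum_i\lambda_i\nabla_yh_i(x,y)=0$; $y$ is a *KKT point* if it belongs to some KKT triple. An *ICNN* is a network $z_1=\sigma_1(W^{(y)}_0y+b_0)$, $z_{i+1}=\sigma_{i+1}(W^{(z)}_iz_i+W^{(y)}_iy+b_i)$ with any number of layers of any widths, componentwise convex nondecreasing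 activations $\sigma_i$, entrywise nonnegative $W^{(z)}_i$, arbitrary $W^{(y)}_i,b_i$, and one output $f_\theta(y)\in\mathbb R$. With $t^+=\max\{t,0\}$, we consider two variants of the augmented Lagrangian method (ALM): * *ReLU*: $L_\rho(y;\mu,\lambda)=f+\sum_j\mu_jg_j^++\sum_i\lambda_ih_i+\frac\rho2\big(\sum_j(g_j^+)^2+\sum_ih_i^2\big)$, with update $\mu_j\leftarrow\max\{\mu_j+\rho g_j^+,0\}$; * *standard*: $L_\rho(y;\mu,\lambda)=f+\sum_i\lambda_ih_i+\frac\rho2\sum_ih_i^2+\frac1{2\rho}\sum_j\big(((\mu_j+\rho g_j)^+)^2-\mu_j^2\big)$, with update $\mu_j\leftarrow(\mu_j+\rho g_j)^+$. Let $\tau\in(0,1)$, $\alpha>1$. A *run* for $x$ starts from $\mu^0\ge0$, $\lambda^0$, $\rho^0>0$. In step $k\ge0$, $y^{k+1}$ is a minimizer over $\mathcal Y$ of an ICNN $f_{\theta_k}$ such that $$L_{\rho^k}(y^{k+1};\mu^k,\lambda^k)\le\min_{y\in\mathcal Y}L_{\rho^k}(y;\mu^k,\lambda^k)+\epsilon_k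 ;$$ then $\mu^{k+1}$ is obtained from $\mu^k$ by the update of the variant with $\rho=\rho^k$, $y=y^{k+1}$, and $\lambda^{k+1}=\lambda^k+\rho^kh(x,y^{k+1})$. Put $\nu_{k+1}=\max\{\|h(x,y^{k+1})\|_\infty,\ \max_j|\max\{g_j(x,y^{k+1}),-\mu^k_j/\rho^k\}|\}$. The penalty parameters satisfy $\rho^{k+1}\ge\rho^k$ for all $k\ge 0$, and $\rho^{k+1}\ge\alpha\rho^k$ whenever $k\ge1$ and $\nu_{k+1}>\tau\nu_k$. **Theorem (Convergence to KKT point).** Let $x\in X$. 1. For both variants, all $\rho>0$, $\mu\ge0$, $\lambda$ and $\epsilon>0$, there is an ICNN $f_\theta$ which has a minimizer over $\mathcal Y$ and each of whose minimizers over $\mathcal Y$ minimizes $L_\rho(\cdot;\mu,\lambda)$ over $\mathcal Y$ up to $\epsilon$. 2. For every run of either variant with $\epsilon_k\to0$, the sequence $(y^k)$ has a limit point, every limit point of $(y^k)$ is a KKT point, and the distance from $y^k$ to the set of KKT points tends to $0$. 3. If moreover $\rho^k\epsilon_k\to0$, then for the standard variant the multipliers $(\mu^k,\lambda^k)$ are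 bounded and every limit point $(\bar y,\bar\mu,\bar\lambda)$ of $(y^k,\mu^k,\lambda^k)$ is a KKT triple; for the ReLU variant, for every limit point $(\bar y,\bar\mu,\bar\lambda)$ of $(y^k,\mu^k,\lambda^k)$ there is $\mu'\le\bar\mu$ such that $(\bar y,\mu',\bar\lambda)$ is a KKT triple. -/

import Mathlib

open Filter Topology Set Matrix

noncomputable section

/-- The first layers of an input convex neural network on `ℝⁿ`, with `m` units in the last of them.
The first layer is `z₁ = σ (Wy y + b)`, every later one is `z' = σ (Wz z + Wy y + b)` with
`Wz` entrywise nonnegative and with a "passthrough" matrix `Wy` of arbitrary sign.  All activations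
are convex and nondecreasing and act componentwise. -/
inductive ICNNLayers (n : ℕ) : ℕ → Type
  | input {m : ℕ} (σ : ℝ → ℝ) (hconv : ConvexOn ℝ univ σ) (hmono : Monotone σ)
      (Wy : Matrix (Fin m) (Fin n) ℝ) (b : Fin m → ℝ) : ICNNLayers n m
  | next {m m' : ℕ} (prev : ICNNLayers n m)
      (σ : ℝ → ℝ) (hconv : ConvexOn ℝ univ σ) (hmono : Monotone σ)
      (Wz : Matrix (Fin m') (Fin m) ℝ) (hWz : ∀ i j, 0 ≤ Wz i j)
      (Wy : Matrix (Fin m') (Fin n) ℝ) (b : Fin m' → ℝ) : ICNNLayers n m'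

/-- The vector of units in the last layer, as a function of the network input. -/
def ICNNLayers.units {n : ℕ} : {m : ℕ} → ICNNLayers n m → EuclideanSpace ℝ (Fin n) → (Fin m → ℝ)
  | _, .input σ _ _ Wy b, y => fun i => σ ((Wy *ᵥ y.ofLp) i + b i)
  | _, .next prev σ _ _ Wz _ Wy b, y =>
      fun i => σ ((Wz *ᵥ prev.units y) i + (Wy *ᵥ y.ofLp) i + b i)

/-- An input convex neural network on `ℝⁿ`: any positive number of layers, one output unit. -/
abbrev ICNN (n : ℕ) : Type := ICNNLayers n 1

/-- The scalar function `y ↦ f_θ(y)` computed by an input convex neural network. -/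
def ICNN.eval {n : ℕ} (θ : ICNN n) (y : EuclideanSpace ℝ (Fin n)) : ℝ :=
  ICNNLayers.units θ y 0

/-- Data of the parametric problem `min_{y ∈ 𝒴} f(x,y)` subject to `g(x,y) ≤ 0`, `h(x,y) = 0`, for
parameters `x ∈ X ⊆ ℝᵈ`, with `y ∈ 𝒴 ⊆ ℝⁿ`, `p` inequality and `q` equality constraints. -/
structure ParamProblem (d n p q : ℕ) where
  X : Set (EuclideanSpace ℝ (Fin d))
  Y : Set (EuclideanSpace ℝ (Fin n))
  f : EuclideanSpace ℝ (Fin d) → EuclideanSpace ℝ (Fin n) → ℝ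
  g : EuclideanSpace ℝ (Fin d) → EuclideanSpace ℝ (Fin n) → Fin p → ℝ
  h : EuclideanSpace ℝ (Fin d) → EuclideanSpace ℝ (Fin n) → Fin q → ℝ

/-- The two forms of the augmented Lagrangian method: `relu` applies `ReLU` to the inequality
constraints in the augmented Lagrangian and in the multiplier update, `standard` is the classical
(Powell-Hestenes-Rockafellar) form. -/
inductive ALMVariant
  | relu
  | standard

namespace ParamProblem

variable {d n p q : ℕ} (P : ParamProblem d n p q) (x : EuclideanSpace ℝ (Fin d))

/-- The feasible region `Y(x)`. -/
def feasible : Set (EuclideanSpace ℝ (Fin n)) :=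
  {y | y ∈ P.Y ∧ (∀ j, P.g x y j ≤ 0) ∧ ∀ i, P.h x y i = 0}

/-- `∇_y f(x,y)`. -/
def gradF (y : EuclideanSpace ℝ (Fin n)) : EuclideanSpace ℝ (Fin n) :=
  gradient (P.f x) y

/-- `∇_y g_j(x,y)`. -/
def gradG (y : EuclideanSpace ℝ (Fin n)) (j : Fin p) : EuclideanSpace ℝ (Fin n) :=
  gradient (fun z => P.g x z j) y

/-- `∇_y h_i(x,y)`. -/
def gradH (y : EuclideanSpace ℝ (Fin n)) (i : Fin q) : EuclideanSpace ℝ (Fin n) :=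
  gradient (fun z => P.h x z i) y

/-- Linear independence constraint qualification at `y`: the gradients of the active inequality
constraints and of the equality constraints form a linearly independent family. -/
def LICQ (y : EuclideanSpace ℝ (Fin n)) : Prop :=
  LinearIndependent ℝ
    (Sum.elim (fun j : {j : Fin p // P.g x y j = 0} => P.gradG x y j) (P.gradH x y))

/-- Mangasarian-Fromovitz constraint qualification at `y`. -/
def MFCQ (y : EuclideanSpace ℝ (Fin n)) : Prop :=
  LinearIndependent ℝ (P.gradH x y) ∧
    ∃ v : EuclideanSpace ℝ (Fin n),
      (∀ i, inner ℝ (P.gradH x y i) v = 0) ∧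
      ∀ j, P.g x y j = 0 → inner ℝ (P.gradG x y j) v < 0

/-- `(y, μ, lam)` satisfies the Karush-Kuhn-Tucker conditions. -/
structure IsKKTTriple (y : EuclideanSpace ℝ (Fin n)) (μ : Fin p → ℝ) (lam : Fin q → ℝ) : Prop where
  primal : y ∈ P.feasible x
  dual : ∀ j, 0 ≤ μ j
  slack : ∀ j, μ j * P.g x y j = 0
  stationary : P.gradF x y + ∑ j, μ j • P.gradG x y j + ∑ i, lam i • P.gradH x y i = 0

/-- `y` is a KKT point: it satisfies the KKT conditions with some multipliers. -/
def IsKKTPoint (y : EuclideanSpace ℝ (Fin n)) : Prop :=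
  ∃ (μ : Fin p → ℝ) (lam : Fin q → ℝ), P.IsKKTTriple x y μ lam

/-- The standing assumptions: `𝒴` is compact, and for every parameter `x ∈ X` the feasible region is
nonempty, compact and interior to `𝒴`, the functions are `C¹` in `y` on `𝒴`, and every feasible
point satisfies MFCQ or LICQ. -/
structure Regular : Prop where
  compact_Y : IsCompact P.Y
  nonempty : ∀ x ∈ P.X, (P.feasible x).Nonempty
  compact : ∀ x ∈ P.X, IsCompact (P.feasible x)
  interior : ∀ x ∈ P.X, P.feasible x ⊆ interior P.Y
  smooth_f : ∀ x ∈ P.X, ContDiffOn ℝ 1 (P.f x) P.Y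
  smooth_g : ∀ x ∈ P.X, ∀ j, ContDiffOn ℝ 1 (fun y => P.g x y j) P.Y
  smooth_h : ∀ x ∈ P.X, ∀ i, ContDiffOn ℝ 1 (fun y => P.h x y i) P.Y
  cq : ∀ x ∈ P.X, ∀ y ∈ P.feasible x, P.MFCQ x y ∨ P.LICQ x y

/-- The augmented Lagrangian `L_ρ(y; μ, lam)`. -/
def augLag (v : ALMVariant) (ρ : ℝ) (μ : Fin p → ℝ) (lam : Fin q → ℝ)
    (y : EuclideanSpace ℝ (Fin n)) : ℝ :=
  match v with
  | .relu =>
      P.f x y + ∑ j, μ j * max (P.g x y j) 0 + ∑ i, lam i * P.h x y i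
        + ρ / 2 * (∑ j, (max (P.g x y j) 0) ^ 2 + ∑ i, (P.h x y i) ^ 2)
  | .standard =>
      P.f x y + ∑ i, lam i * P.h x y i + ρ / 2 * ∑ i, (P.h x y i) ^ 2
        + 1 / (2 * ρ) * ∑ j, ((max 0 (μ j + ρ * P.g x y j)) ^ 2 - μ j ^ 2)

/-- The updated multiplier of the inequality constraints. -/
def updateMu (v : ALMVariant) (ρ : ℝ) (μ : Fin p → ℝ) (y : EuclideanSpace ℝ (Fin n)) : Fin p → ℝ :=
  match v with
  | .relu => fun j => max (μ j + ρ * max (P.g x y j) 0) 0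
  | .standard => fun j => max 0 (μ j + ρ * P.g x y j)

/-- The updated multiplier of the equality constraints. -/
def updateLam (ρ : ℝ) (lam : Fin q → ℝ) (y : EuclideanSpace ℝ (Fin n)) : Fin q → ℝ :=
  fun i => lam i + ρ * P.h x y i

/-- The violation measure `ν = max {‖h(x,y)‖_∞, ‖σ‖_∞}`, `σ_j = max {g_j(x,y), -μ_j/ρ}`
(the norms of `Fin p → ℝ` and `Fin q → ℝ` are maximum norms). -/
def violation (ρ : ℝ) (μ : Fin p → ℝ) (y : EuclideanSpace ℝ (Fin n)) : ℝ :=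
  max ‖P.h x y‖ ‖fun j => max (P.g x y j) (-(μ j) / ρ)‖

/-- The sequences `y, μ, lam, ρ` are generated by the augmented Lagrangian method for the parameter
`x`, with initial multipliers `μ 0 ≥ 0`, `lam 0`, initial penalty `ρ 0 > 0`, growth factor `α` and
tolerance factor `τ`, where in step `k` the subproblem of minimizing `L_{ρ k}(·; μ k, lam k)` over
`𝒴` is replaced by minimizing the network `θ k`, with resulting error at most `ε k` in the value
of the augmented Lagrangian.  (`y 0` plays no role.) -/
structure IsICNNALMRun (v : ALMVariant) (τ α : ℝ) (ε : ℕ → ℝ) (θ : ℕ → ICNN n)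
    (y : ℕ → EuclideanSpace ℝ (Fin n)) (μ : ℕ → Fin p → ℝ) (lam : ℕ → Fin q → ℝ)
    (ρ : ℕ → ℝ) : Prop where
  mu_zero : ∀ j, 0 ≤ μ 0 j
  rho_zero : 0 < ρ 0
  mem : ∀ k, y (k + 1) ∈ P.Y
  argmin : ∀ k, IsMinOn (θ k).eval P.Y (y (k + 1))
  accuracy : ∀ k, ∀ z ∈ P.Y,
    P.augLag x v (ρ k) (μ k) (lam k) (y (k + 1)) ≤ P.augLag x v (ρ k) (μ k) (lam k) z + ε k
  mu_succ : ∀ k, μ (k + 1) = P.updateMu x v (ρ k) (μ k) (y (k + 1))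
  lam_succ : ∀ k, lam (k + 1) = P.updateLam x (ρ k) (lam k) (y (k + 1))
  rho_mono : ∀ k, ρ k ≤ ρ (k + 1)
  rho_growth : ∀ k,
    τ * P.violation x (ρ k) (μ k) (y (k + 1)) <
        P.violation x (ρ (k + 1)) (μ (k + 1)) (y (k + 2)) →
      α * ρ (k + 1) ≤ ρ (k + 2)

end ParamProblem

end

/-!
An augmented Lagrangian is continuous on the compact set `𝒴`, so it has a minimizer `y₀`, and the
network that computes the `ℓ¹` distance to `y₀` has `y₀` as its only minimizer
(`ICNN.exists_isMinOn_imp`).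

For a run, the violation tends to zero (`ParamProblem.IsICNNALMRun.tendsto_violation`), although the
multipliers are not safeguarded.  Up to a constant, the augmented Lagrangian is `f` plus `1 / (2 ρ)`
times the squared norm of the updated multipliers; comparison with a feasible point therefore bounds
the growth of the squared norm in one step by a multiple of `ρ`.  The step is also bounded by a
multiple of `ρ ν`, and either `ν` contracts or `ρ` grows by the factor `α`.  A potential function
that combines these facts shows that the multipliers are `o(ρ)` when `ρ → ∞`, which forces `ν → 0`;
for bounded `ρ` the violation decays geometrically (`tendsto_violation_zero`).

The optimality conditions are read off from nearby points.  The minimizer `z` over `𝒴` of the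
augmented Lagrangian plus `κ ‖· - y‖²`, where `y` is an iterate of accuracy `ε`, satisfies
`κ ‖z - y‖² ≤ ε`, and if it is interior, then the gradient there has norm at most `2 √(κ ε)`.  For
the `relu` form this is applied to a smooth function that is uniformly close, at the expense of an
arbitrarily small increase of `ε`
(`ParamProblem.Regular.exists_approx_kkt`).  By MFCQ or LICQ the multipliers at such points stay
bounded when the points converge to a feasible point, and their limits are KKT multipliers
(`ParamProblem.Regular.exists_tendsto_isKKTTriple`).  With `κ = 1` this proves that limit points are
KKT points.  With `κ = ρ` and `ρ ε → 0` one has `ρ ‖z - y‖ → 0`, so the multipliers at `z` have the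
same limits as the multipliers of the method; for the `relu` form those of the inequalities are only
bounded by them (`ParamProblem.IsICNNALMRun.exists_multiplier_limits`).

Limit points are handled by ultrafilters finer than `atTop`, along which every bounded sequence
converges, so that no subsequences have to be chosen.
-/

/-! ### Exact minimization through a network -/

/-- The `ℓ¹` distance to a point is computed by an input convex neural network with one hidden ReLU
layer: `|t| = 2 max t 0 - t`, where the linear term is supplied by the passthrough matrix. -/
theorem ICNN.exists_eval_eq_sum_abs {n : ℕ} (y₀ : EuclideanSpace ℝ (Fin n)) :
    ∃ θ : ICNN n, ∀ y, θ.eval y = ∑ i, |y i - y₀ i| := by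
  have hid : ConvexOn ℝ univ (fun t : ℝ => t) := convexOn_id convex_univ
  have hrelu : ConvexOn ℝ univ (fun t : ℝ => max t 0) :=
    hid.sup (convexOn_const 0 convex_univ)
  refine ⟨.next (m := n)
    (.input (fun t => max t 0) hrelu (fun a b h => max_le_max_right 0 h) 1 (fun i => -y₀ i))
    (fun t => t) hid monotone_id (fun _ _ => 2) (fun _ _ => by norm_num) (fun _ _ => -1)
    (fun _ => ∑ i, y₀ i), fun y => ?_⟩
  simp only [ICNN.eval, ICNNLayers.units, one_mulVec]
  simp only [mulVec, dotProduct]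
  rw [← Finset.sum_add_distrib, ← Finset.sum_add_distrib]
  refine Finset.sum_congr rfl fun i _ => ?_
  rcases le_total 0 (y i - y₀ i) with h | h
  · rw [abs_of_nonneg h, max_eq_left (by linarith)]; ring
  · rw [abs_of_nonpos h, max_eq_right (by linarith)]; ring

/-- A function that attains its minimum on `s` can be minimized exactly through a network whose only
minimizer is one of its minimizers. -/
theorem ICNN.exists_isMinOn_imp {n : ℕ} {s : Set (EuclideanSpace ℝ (Fin n))}
    {F : EuclideanSpace ℝ (Fin n) → ℝ} {y₀ : EuclideanSpace ℝ (Fin n)} (hy₀ : y₀ ∈ s)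
    (hF : IsMinOn F s y₀) :
    ∃ θ : ICNN n, (∃ y ∈ s, IsMinOn θ.eval s y) ∧
      ∀ y ∈ s, IsMinOn θ.eval s y → IsMinOn F s y := by
  obtain ⟨θ, hθ⟩ := ICNN.exists_eval_eq_sum_abs y₀
  have h0 : θ.eval y₀ = 0 := by simp [hθ]
  refine ⟨θ, ⟨y₀, hy₀, fun z _ => ?_⟩, fun y _ hy => ?_⟩
  · rw [mem_ofPred_eq, h0, hθ]; positivity
  · have h1 : ∑ i, |y i - y₀ i| ≤ 0 := by rw [← hθ, ← h0]; exact hy hy₀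
    have h2 := (Finset.sum_eq_zero_iff_of_nonneg fun i _ => abs_nonneg (y i - y₀ i)).1
      (le_antisymm h1 (by positivity))
    have : y = y₀ := by
      ext i
      have := h2 i (Finset.mem_univ i)
      rwa [abs_eq_zero, sub_eq_zero] at this
    rwa [this]

namespace ParamProblem

variable {d n p q : ℕ} {P : ParamProblem d n p q} {x : EuclideanSpace ℝ (Fin d)}

theorem Regular.continuousOn_augLag (hP : P.Regular) (hx : x ∈ P.X) (v : ALMVariant) (ρ : ℝ)
    (μ : Fin p → ℝ) (lam : Fin q → ℝ) : ContinuousOn (P.augLag x v ρ μ lam) P.Y := by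
  have hf := (hP.smooth_f x hx).continuousOn
  have hg := fun j => (hP.smooth_g x hx j).continuousOn
  have hh := fun i => (hP.smooth_h x hx i).continuousOn
  cases v <;> unfold augLag <;> fun_prop

end ParamProblem

/-! ### A convergence lemma for sequences of violations -/

/-- Convergence of the violations `ν` to zero in the augmented Lagrangian method, in terms of the
norms `M` of the multipliers and of the penalties `ρ`.  If `ρ` is bounded then `ν` decreases
geometrically from some index on.  Otherwise `M / ρ → 0`, because
`M (k+1) + ρ (k+1) * (B * √(δ * ν k) - E)` is eventually nonincreasing for every `δ > 0`, where `E`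
tends to zero with `δ`. -/
theorem tendsto_violation_zero {M ρ ν : ℕ → ℝ} {τ α C c D : ℝ}
    (hτ : 0 < τ) (hτ1 : τ < 1) (hα : 1 < α) (hc : 0 ≤ c)
    (hρ0 : 0 < ρ 0) (hρ : Monotone ρ) (hM : ∀ k, 0 ≤ M k) (hν : ∀ k, 0 ≤ ν k)
    (hνD : ∀ k, ν k ≤ D)
    (hMsq : ∀ k, M (k + 1) ^ 2 ≤ M k ^ 2 + C * ρ k)
    (hMν : ∀ k, M (k + 1) ≤ M k + c * (ρ k * ν k))
    (hνM : ∀ k, ρ k * ν k ≤ M k + M (k + 1))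
    (hgrow : ∀ k, τ * ν k < ν (k + 1) → α * ρ (k + 1) ≤ ρ (k + 2)) :
    Tendsto ν atTop (𝓝 0) := by
  have hρpos : ∀ k, 0 < ρ k := fun k => hρ0.trans_le (hρ k.zero_le)
  rcases tendsto_atTop_of_monotone hρ with hinf | ⟨r, hr⟩
  · -- the penalties are unbounded
    have hD : 0 ≤ D := (hν 0).trans (hνD 0)
    have hstep : ∀ δ > 0, ∀ᶠ k in atTop, M (k + 1) ≤ M k + δ * ρ k := by
      intro δ hδ
      filter_upwards [hinf.eventually_ge_atTop (C / δ ^ 2)] with k hk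
      have h1 : C ≤ ρ k * δ ^ 2 := (div_le_iff₀ (by positivity)).1 hk
      have h2 : 0 ≤ 2 * M k * (δ * ρ k) := by have := hM k; have := hρpos k; positivity
      refine abs_le_of_sq_le_sq' ?_ (by have := hM k; have := hρpos k; positivity) |>.2
      nlinarith [hMsq k, mul_le_mul_of_nonneg_right h1 (hρpos k).le]
    have hMρ : Tendsto (fun k => M (k + 1) / ρ (k + 1)) atTop (𝓝 0) := by
      -- the solution of `√(c τ) + B √τ = B`, which makes the potential nonincreasing when
      -- `ν` contracts
      set B : ℝ := √(c * τ) / (1 - √τ) with hB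
      have hτs : √τ < 1 := by rw [Real.sqrt_lt' one_pos]; simpa using hτ1
      have hBnn : 0 ≤ B := div_nonneg (Real.sqrt_nonneg _) (by linarith)
      have hBeq : √(c * τ) + B * √τ = B := by
        have : (1 - √τ) ≠ 0 := by linarith
        rw [hB]; field_simp; ring
      have hα1 : 0 < 1 - 1 / α := by
        have : 1 / α < 1 := by rw [div_lt_one (by linarith)]; exact hα
        linarith
      -- the asymptotic bound on `M / ρ` for steps of size `δ ρ`; it solves
      -- `E = δ + B √(δ D) + E / α`, so that the potential is also nonincreasing when `ρ` grows
      let E : ℝ → ℝ := fun δ => (δ + B * √(δ * D)) / (1 - 1 / α)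
      have hE0 : Tendsto E (𝓝[>] 0) (𝓝 0) := by
        have : Continuous E := by fun_prop
        have h := this.tendsto 0
        simp only [E, zero_mul, Real.sqrt_zero, mul_zero, add_zero, zero_div] at h
        exact h.mono_left nhdsWithin_le_nhds
      have hbound : ∀ δ > 0, ∃ Q : ℝ, ∀ᶠ k in atTop, M (k + 1) ≤ Q + ρ (k + 1) * E δ := by
        intro δ hδ
        obtain ⟨K, hK⟩ := eventually_atTop.1 (hstep δ hδ)
        have hEeq : E δ = δ + B * √(δ * D) + E δ * (1 / α) := by
          simp only [E]; field_simp
          have : α - 1 ≠ 0 := by linarith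
          field_simp; ring
        have hEnn : 0 ≤ E δ := div_nonneg (by positivity) hα1.le
        let Q : ℕ → ℝ := fun k => M (k + 1) + ρ (k + 1) * (B * √(δ * ν k) - E δ)
        have hQ : ∀ k ≥ K, Q (k + 1) ≤ Q k := by
          intro k hk
          have e1 : √(δ * ν (k + 1)) ≤ √(δ * D) :=
            Real.sqrt_le_sqrt (mul_le_mul_of_nonneg_left (hνD _) hδ.le)
          have hBe : B * √(δ * ν (k + 1)) ≤ B * √(δ * D) := mul_le_mul_of_nonneg_left e1 hBnn
          have hr1 := hρpos (k + 1)
          have hr2 := hρ (Nat.le_succ (k + 1))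
          have hM2 := hK (k + 1) (by omega)
          have hBk : 0 ≤ B * √(δ * ν k) := by positivity
          change M (k + 2) + ρ (k + 2) * (B * √(δ * ν (k + 1)) - E δ) ≤
            M (k + 1) + ρ (k + 1) * (B * √(δ * ν k) - E δ)
          by_cases hcase : τ * ν k < ν (k + 1)
          · have hg := hgrow k hcase
            have h3 : ρ (k + 1) ≤ ρ (k + 2) * (1 / α) := by
              rw [mul_one_div, le_div_iff₀ (by linarith)]; linarith
            have h4 : ρ (k + 2) * (B * √(δ * ν (k + 1)) - E δ) ≤
                ρ (k + 2) * (-δ - E δ * (1 / α)) :=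
              mul_le_mul_of_nonneg_left (by linarith) (hr1.le.trans hr2)
            have h5 := mul_le_mul_of_nonneg_right h3 hEnn
            have h6 : ρ (k + 1) * δ ≤ ρ (k + 2) * δ := mul_le_mul_of_nonneg_right hr2 hδ.le
            have h7 := mul_nonneg hr1.le hBk
            nlinarith
          · -- `min (δ, c ν) ≤ √(δ c ν)` turns the two bounds on the step into one
            have hν' := not_lt.1 hcase
            have h3 : M (k + 2) ≤ M (k + 1) + ρ (k + 1) * √(δ * (c * ν (k + 1))) := by
              have h4 := hMν (k + 1)
              have hcn : 0 ≤ c * ν (k + 1) := mul_nonneg hc (hν _)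
              rcases le_total δ (c * ν (k + 1)) with h | h
              · have : δ ≤ √(δ * (c * ν (k + 1))) :=
                  Real.le_sqrt_of_sq_le (by nlinarith)
                nlinarith
              · have : c * ν (k + 1) ≤ √(δ * (c * ν (k + 1))) :=
                  Real.le_sqrt_of_sq_le (by nlinarith)
                nlinarith
            have h4 : √(δ * (c * ν (k + 1))) ≤ √(c * τ) * √(δ * ν k) := by
              rw [← Real.sqrt_mul (by positivity)]
              apply Real.sqrt_le_sqrt
              have := mul_le_mul_of_nonneg_left hν' (mul_nonneg hδ.le hc)
              linarith
            have h5 : B * √(δ * ν (k + 1)) ≤ B * √τ * √(δ * ν k) := by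
              rw [mul_assoc, ← Real.sqrt_mul hτ.le]
              refine mul_le_mul_of_nonneg_left (Real.sqrt_le_sqrt ?_) hBnn
              have := mul_le_mul_of_nonneg_left hν' hδ.le
              linarith
            have h6 : √(c * τ) * √(δ * ν k) + B * √τ * √(δ * ν k) = B * √(δ * ν k) := by
              rw [← add_mul, hBeq]
            have h7 : B * √(δ * ν (k + 1)) - E δ ≤ 0 := by
              have : 0 ≤ E δ * (1 / α) := by
                have : 0 ≤ 1 / α := by have := hα; positivity
                positivity
              linarith
            have h8 : ρ (k + 2) * (B * √(δ * ν (k + 1)) - E δ) ≤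
                ρ (k + 1) * (B * √(δ * ν (k + 1)) - E δ) :=
              mul_le_mul_of_nonpos_right hr2 h7
            have h9 : ρ (k + 1) * (√(δ * (c * ν (k + 1))) + B * √(δ * ν (k + 1))) ≤
                ρ (k + 1) * (B * √(δ * ν k)) :=
              mul_le_mul_of_nonneg_left (by linarith) hr1.le
            linarith
        refine ⟨Q K, eventually_atTop.2 ⟨K, fun k hk => ?_⟩⟩
        have h1 : Q k ≤ Q K := by
          induction k, hk using Nat.le_induction with
          | base => exact le_rfl
          | succ k hk ih => exact (hQ k hk).trans ih
        have h2 : 0 ≤ ρ (k + 1) * (B * √(δ * ν k)) :=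
          mul_nonneg (hρpos _).le (mul_nonneg hBnn (Real.sqrt_nonneg _))
        simp only [Q] at h1 ⊢
        linarith
      rw [tendsto_order]
      refine ⟨fun a ha => .of_forall fun k => ha.trans_le
        (div_nonneg (hM _) (hρpos _).le), fun a ha => ?_⟩
      obtain ⟨δ, hδE, hδ⟩ := ((hE0.eventually (gt_mem_nhds (half_pos ha))).and
        self_mem_nhdsWithin).exists
      obtain ⟨Q, hQ⟩ := hbound δ hδ
      have hinf' := hinf.comp (tendsto_add_atTop_nat 1)
      filter_upwards [hQ, hinf'.eventually_gt_atTop (Q / (a / 2))] with k hk1 hk2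
      have hp := hρpos (k + 1)
      have h1 : Q < ρ (k + 1) * (a / 2) := (div_lt_iff₀ (by positivity)).1 hk2
      rw [div_lt_iff₀ hp]
      have h2 := mul_lt_mul_of_pos_left hδE hp
      linarith
    rw [← tendsto_add_atTop_iff_nat 1]
    rw [tendsto_order]
    refine ⟨fun a ha => .of_forall fun k => ha.trans_le (hν _), fun a ha => ?_⟩
    filter_upwards [(tendsto_add_atTop_nat 1).eventually (hstep (a / 2) (by positivity)),
      hMρ.eventually (gt_mem_nhds (show (0 : ℝ) < a / 4 by positivity))] with k h1 h2
    have hp := hρpos (k + 1)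
    rw [div_lt_iff₀ hp] at h2
    have h3 := hνM (k + 1)
    by_contra! h4
    have := mul_le_mul_of_nonneg_left h4 hp.le
    linarith
  · -- the penalties converge, so from some index on none of them is multiplied by `α`
    have hrpos : 0 < r := (hρpos 0).trans_le (hρ.ge_of_tendsto hr 0)
    have h1 : Tendsto (fun k => α * ρ (k + 1)) atTop (𝓝 (α * r)) :=
      ((tendsto_add_atTop_iff_nat 1).2 hr).const_mul α
    have h2 : Tendsto (fun k => ρ (k + 2)) atTop (𝓝 r) := (tendsto_add_atTop_iff_nat 2).2 hr
    obtain ⟨K, hK⟩ := eventually_atTop.1 (h2.eventually_lt h1 (by nlinarith))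
    have hgeo : ∀ i, ν (i + K) ≤ D * τ ^ i := by
      intro i
      induction i with
      | zero => simpa using hνD K
      | succ i ih =>
        have : ν (i + K + 1) ≤ τ * ν (i + K) := by
          by_contra! h
          exact absurd (hgrow _ h) (not_le.2 (hK (i + K) (by omega)))
        rw [show i + 1 + K = i + K + 1 by ring, pow_succ]
        nlinarith
    rw [← tendsto_add_atTop_iff_nat K]
    refine squeeze_zero (fun _ => hν _) hgeo ?_
    simpa using (tendsto_pow_atTop_nhds_zero_of_lt_one hτ.le hτ1).const_mul D

/-! ### Multiplier updates and decay of the violation along a run -/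

/-- The pair of multipliers as one vector with the Euclidean norm: the augmented Lagrangian differs
from `f` by a multiple of the increase of the square of this norm in a multiplier update. -/
noncomputable def multiplierVec {p q : ℕ} (μ : Fin p → ℝ) (lam : Fin q → ℝ) :
    EuclideanSpace ℝ (Fin p ⊕ Fin q) :=
  WithLp.toLp 2 (Sum.elim μ lam)

theorem norm_sq_multiplierVec {p q : ℕ} (μ : Fin p → ℝ) (lam : Fin q → ℝ) :
    ‖multiplierVec μ lam‖ ^ 2 = ∑ j, μ j ^ 2 + ∑ i, lam i ^ 2 := by
  simp [multiplierVec, EuclideanSpace.norm_sq_eq, Fintype.sum_sum_type]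

theorem abs_le_norm_multiplierVec_left {p q : ℕ} (μ : Fin p → ℝ) (lam : Fin q → ℝ) (j : Fin p) :
    |μ j| ≤ ‖multiplierVec μ lam‖ := by
  simpa [multiplierVec] using PiLp.norm_apply_le (multiplierVec μ lam) (Sum.inl j)

theorem abs_le_norm_multiplierVec_right {p q : ℕ} (μ : Fin p → ℝ) (lam : Fin q → ℝ) (i : Fin q) :
    |lam i| ≤ ‖multiplierVec μ lam‖ := by
  simpa [multiplierVec] using PiLp.norm_apply_le (multiplierVec μ lam) (Sum.inr i)

theorem norm_multiplierVec_le_add {p q : ℕ} {μ μ' : Fin p → ℝ} {lam lam' : Fin q → ℝ} {e : ℝ}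
    (he : 0 ≤ e) (hμ : ∀ j, |μ' j - μ j| ≤ e) (hlam : ∀ i, |lam' i - lam i| ≤ e) :
    ‖multiplierVec μ' lam'‖ ≤ ‖multiplierVec μ lam‖ + √(p + q) * e := by
  have h1 : ‖multiplierVec μ' lam' - multiplierVec μ lam‖ ≤ √(p + q) * e := by
    have h2 : multiplierVec μ' lam' - multiplierVec μ lam =
        multiplierVec (μ' - μ) (lam' - lam) := by
      ext i; cases i <;> simp [multiplierVec]
    have h3 : ∑ j, (μ' - μ) j ^ 2 ≤ p * e ^ 2 := by
      have := Finset.sum_le_card_nsmul Finset.univ (fun j => (μ' - μ) j ^ 2) (e ^ 2)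
        fun j _ => by rw [← sq_abs]; exact pow_le_pow_left₀ (abs_nonneg _) (hμ j) 2
      simpa using this
    have h4 : ∑ i, (lam' - lam) i ^ 2 ≤ q * e ^ 2 := by
      have := Finset.sum_le_card_nsmul Finset.univ (fun i => (lam' - lam) i ^ 2) (e ^ 2)
        fun i _ => by rw [← sq_abs]; exact pow_le_pow_left₀ (abs_nonneg _) (hlam i) 2
      simpa using this
    rw [h2]
    refine (pow_le_pow_iff_left₀ (norm_nonneg _) (by positivity) two_ne_zero).1 ?_
    rw [norm_sq_multiplierVec, mul_pow, Real.sq_sqrt (by positivity)]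
    linarith
  have := norm_le_norm_add_norm_sub' (multiplierVec μ' lam') (multiplierVec μ lam)
  linarith

theorem abs_max_neg_le_abs {t m : ℝ} (hm : 0 ≤ m) : |max t (-m)| ≤ |t| := by
  rcases le_total t (-m) with h | h
  · rw [max_eq_right h, abs_neg, abs_of_nonneg hm, abs_of_nonpos (by linarith)]; linarith
  · rw [max_eq_left h]

namespace ParamProblem

variable {d n p q : ℕ} {P : ParamProblem d n p q} {x : EuclideanSpace ℝ (Fin d)}

theorem updateMu_nonneg (v : ALMVariant) (ρ : ℝ) (μ : Fin p → ℝ) (y : EuclideanSpace ℝ (Fin n))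
    (j : Fin p) : 0 ≤ P.updateMu x v ρ μ y j := by
  cases v
  · exact le_max_right _ _
  · exact le_max_left _ _

theorem augLag_eq_add_norm_sq (v : ALMVariant) {ρ : ℝ} (hρ : 0 < ρ) {μ : Fin p → ℝ}
    (hμ : ∀ j, 0 ≤ μ j) (lam : Fin q → ℝ) (y : EuclideanSpace ℝ (Fin n)) :
    P.augLag x v ρ μ lam y = P.f x y + 1 / (2 * ρ) *
      (‖multiplierVec (P.updateMu x v ρ μ y) (P.updateLam x ρ lam y)‖ ^ 2 -
        ‖multiplierVec μ lam‖ ^ 2) := by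
  rw [norm_sq_multiplierVec, norm_sq_multiplierVec]
  have hh : 1 / (2 * ρ) * (∑ i, P.updateLam x ρ lam y i ^ 2 - ∑ i, lam i ^ 2) =
      ∑ i, lam i * P.h x y i + ρ / 2 * ∑ i, P.h x y i ^ 2 := by
    rw [← Finset.sum_sub_distrib, Finset.mul_sum, Finset.mul_sum, ← Finset.sum_add_distrib]
    refine Finset.sum_congr rfl fun i _ => ?_
    simp only [updateLam]; field_simp; ring
  cases v
  · have hg : 1 / (2 * ρ) * (∑ j, P.updateMu x .relu ρ μ y j ^ 2 - ∑ j, μ j ^ 2) =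
        ∑ j, μ j * max (P.g x y j) 0 + ρ / 2 * ∑ j, max (P.g x y j) 0 ^ 2 := by
      rw [← Finset.sum_sub_distrib, Finset.mul_sum, Finset.mul_sum, ← Finset.sum_add_distrib]
      refine Finset.sum_congr rfl fun j _ => ?_
      have : 0 ≤ μ j + ρ * max (P.g x y j) 0 :=
        add_nonneg (hμ j) (mul_nonneg hρ.le (le_max_right _ _))
      simp only [updateMu, max_eq_left this]; field_simp; ring
    simp only [augLag]
    linear_combination -hg - hh
  · simp only [augLag, updateMu, Finset.sum_sub_distrib] at *
    linear_combination -hh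

theorem augLag_le_of_mem_feasible (v : ALMVariant) {ρ : ℝ} (hρ : 0 < ρ) {μ : Fin p → ℝ}
    (hμ : ∀ j, 0 ≤ μ j) (lam : Fin q → ℝ) {z : EuclideanSpace ℝ (Fin n)}
    (hz : z ∈ P.feasible x) : P.augLag x v ρ μ lam z ≤ P.f x z := by
  obtain ⟨-, hg, hh⟩ := hz
  cases v
  · simp [augLag, hg, hh]
  · have : ∑ j, ((max 0 (μ j + ρ * P.g x z j)) ^ 2 - μ j ^ 2) ≤ 0 := by
      refine Finset.sum_nonpos fun j _ => sub_nonpos.2 ?_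
      refine pow_le_pow_left₀ (le_max_left _ _) (max_le (hμ j) ?_) 2
      have := mul_nonpos_of_nonneg_of_nonpos hρ.le (hg j)
      linarith
    have := mul_nonpos_of_nonneg_of_nonpos (show 0 ≤ 1 / (2 * ρ) by positivity) this
    simp only [augLag, hh]
    simp only [mul_zero, Finset.sum_const_zero, ne_eq, OfNat.ofNat_ne_zero, not_false_eq_true,
      zero_pow, add_zero]
    linarith

theorem violation_nonneg (ρ : ℝ) (μ : Fin p → ℝ) (y : EuclideanSpace ℝ (Fin n)) :
    0 ≤ P.violation x ρ μ y :=
  le_max_of_le_left (norm_nonneg _)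

theorem abs_h_le_violation (ρ : ℝ) (μ : Fin p → ℝ) (y : EuclideanSpace ℝ (Fin n)) (i : Fin q) :
    |P.h x y i| ≤ P.violation x ρ μ y :=
  (norm_le_pi_norm (P.h x y) i).trans (le_max_left _ _)

theorem abs_max_le_violation (ρ : ℝ) (μ : Fin p → ℝ) (y : EuclideanSpace ℝ (Fin n)) (j : Fin p) :
    |max (P.g x y j) (-(μ j) / ρ)| ≤ P.violation x ρ μ y :=
  (norm_le_pi_norm (fun j => max (P.g x y j) (-(μ j) / ρ)) j).trans (le_max_right _ _)

theorem violation_le {ρ : ℝ} (hρ : 0 < ρ) {μ : Fin p → ℝ} (hμ : ∀ j, 0 ≤ μ j)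
    (y : EuclideanSpace ℝ (Fin n)) : P.violation x ρ μ y ≤ max ‖P.h x y‖ ‖P.g x y‖ := by
  refine max_le_max_left _ ((pi_norm_le_iff_of_nonneg (norm_nonneg _)).2 fun j => ?_)
  rw [neg_div]
  exact (abs_max_neg_le_abs (div_nonneg (hμ j) hρ.le)).trans (norm_le_pi_norm (P.g x y) j)

theorem abs_updateMu_sub_le (v : ALMVariant) {ρ : ℝ} (hρ : 0 < ρ) {μ : Fin p → ℝ}
    (hμ : ∀ j, 0 ≤ μ j) (y : EuclideanSpace ℝ (Fin n)) (j : Fin p) :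
    |P.updateMu x v ρ μ y j - μ j| ≤ ρ * P.violation x ρ μ y := by
  refine le_trans ?_ (mul_le_mul_of_nonneg_left (abs_max_le_violation ρ μ y j) hρ.le)
  have hdiv : ρ * (-(μ j) / ρ) = -μ j := by field_simp
  have habs : ρ * |max (P.g x y j) (-(μ j) / ρ)| = |max (ρ * P.g x y j) (-μ j)| := by
    nth_rw 1 [← abs_of_pos hρ]
    rw [← abs_mul, mul_max_of_nonneg _ _ hρ.le, hdiv]
  rw [habs]
  cases v
  · have h0 : 0 ≤ ρ * max (P.g x y j) 0 := mul_nonneg hρ.le (le_max_right _ _)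
    simp only [updateMu, max_eq_left (add_nonneg (hμ j) h0), add_sub_cancel_left]
    rw [abs_of_nonneg h0, mul_max_of_nonneg _ _ hρ.le, mul_zero]
    rcases le_total 0 (ρ * P.g x y j) with h | h
    · rw [max_eq_left h]; exact (le_max_left _ _).trans (le_abs_self _)
    · rw [max_eq_right h]; exact abs_nonneg _
  · simp only [updateMu]
    rw [max_comm, ← max_sub_sub_right]
    simp

theorem abs_updateLam_sub_le {ρ : ℝ} (hρ : 0 < ρ) (μ : Fin p → ℝ) (lam : Fin q → ℝ)
    (y : EuclideanSpace ℝ (Fin n)) (i : Fin q) :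
    |P.updateLam x ρ lam y i - lam i| ≤ ρ * P.violation x ρ μ y := by
  simp only [updateLam, add_sub_cancel_left, abs_mul, abs_of_pos hρ]
  exact mul_le_mul_of_nonneg_left (abs_h_le_violation ρ μ y i) hρ.le

theorem rho_mul_violation_le (v : ALMVariant) {ρ : ℝ} (hρ : 0 < ρ) {μ : Fin p → ℝ}
    (hμ : ∀ j, 0 ≤ μ j) (lam : Fin q → ℝ) (y : EuclideanSpace ℝ (Fin n)) :
    ρ * P.violation x ρ μ y ≤ ‖multiplierVec μ lam‖ +
      ‖multiplierVec (P.updateMu x v ρ μ y) (P.updateLam x ρ lam y)‖ := by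
  set R := ‖multiplierVec μ lam‖ +
      ‖multiplierVec (P.updateMu x v ρ μ y) (P.updateLam x ρ lam y)‖ with hR
  have hR0 : 0 ≤ R := by positivity
  rw [← le_div_iff₀' hρ]
  refine max_le ((pi_norm_le_iff_of_nonneg (by positivity)).2 fun i => ?_)
    ((pi_norm_le_iff_of_nonneg (by positivity)).2 fun j => ?_)
  · rw [le_div_iff₀' hρ, Real.norm_eq_abs]
    have h1 := abs_le_norm_multiplierVec_right μ lam i
    have h2 := abs_le_norm_multiplierVec_right (P.updateMu x v ρ μ y) (P.updateLam x ρ lam y) i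
    have h3 : ρ * |P.h x y i| = |P.updateLam x ρ lam y i - lam i| := by
      simp [updateLam, abs_mul, abs_of_pos hρ]
    rw [h3]
    have := abs_sub (P.updateLam x ρ lam y i) (lam i)
    linarith
  · rw [le_div_iff₀' hρ, Real.norm_eq_abs]
    have h1 := abs_le_norm_multiplierVec_left μ lam j
    have h2 := abs_le_norm_multiplierVec_left (P.updateMu x v ρ μ y) (P.updateLam x ρ lam y) j
    rw [abs_of_nonneg (hμ j)] at h1
    rw [abs_of_nonneg (updateMu_nonneg v ρ μ y j)] at h2
    have hm := hμ j
    have h3 : ρ * P.g x y j ≤ P.updateMu x v ρ μ y j := by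
      cases v
      · have := mul_le_mul_of_nonneg_left (le_max_left (P.g x y j) 0) hρ.le
        exact le_max_of_le_left (by linarith)
      · exact le_max_of_le_right (by linarith)
    have hdiv : ρ * (-(μ j) / ρ) = -μ j := by field_simp
    nth_rw 1 [← abs_of_pos hρ]
    rw [← abs_mul, mul_max_of_nonneg _ _ hρ.le, hdiv]
    refine abs_le.2 ⟨?_, max_le ?_ ?_⟩
    · have := le_max_right (ρ * P.g x y j) (-μ j)
      have := norm_nonneg (multiplierVec (P.updateMu x v ρ μ y) (P.updateLam x ρ lam y))
      linarith
    · have := norm_nonneg (multiplierVec μ lam)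
      linarith
    · linarith

namespace IsICNNALMRun

variable {v : ALMVariant} {τ α : ℝ} {ε : ℕ → ℝ} {θ : ℕ → ICNN n}
  {y : ℕ → EuclideanSpace ℝ (Fin n)} {μ : ℕ → Fin p → ℝ} {lam : ℕ → Fin q → ℝ} {ρ : ℕ → ℝ}

theorem mu_nonneg (hR : P.IsICNNALMRun x v τ α ε θ y μ lam ρ) (k : ℕ) (j : Fin p) :
    0 ≤ μ k j := by
  cases k with
  | zero => exact hR.mu_zero j
  | succ k => rw [hR.mu_succ]; exact updateMu_nonneg _ _ _ _ j

theorem rho_zero_le (hR : P.IsICNNALMRun x v τ α ε θ y μ lam ρ) (k : ℕ) : ρ 0 ≤ ρ k :=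
  monotone_nat_of_le_succ hR.rho_mono k.zero_le

theorem rho_pos (hR : P.IsICNNALMRun x v τ α ε θ y μ lam ρ) (k : ℕ) : 0 < ρ k :=
  hR.rho_zero.trans_le (hR.rho_zero_le k)

theorem tendsto_violation (hP : P.Regular) (hx : x ∈ P.X)
    (hτ : 0 < τ) (hτ1 : τ < 1) (hα : 1 < α)
    (hR : P.IsICNNALMRun x v τ α ε θ y μ lam ρ) (hε : Tendsto ε atTop (𝓝 0)) :
    Tendsto (fun k => P.violation x (ρ k) (μ k) (y (k + 1))) atTop (𝓝 0) := by
  have hρ := hR.rho_pos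
  have hμ := hR.mu_nonneg
  obtain ⟨z, hz⟩ := hP.nonempty x hx
  obtain ⟨E, hE⟩ := hε.bddAbove_range
  obtain ⟨F, hF⟩ := (hP.compact_Y.image_of_continuousOn (hP.smooth_f x hx).continuousOn).bddBelow
  have hg : ContinuousOn (P.g x) P.Y :=
    continuousOn_pi.2 fun j => (hP.smooth_g x hx j).continuousOn
  have hh : ContinuousOn (P.h x) P.Y :=
    continuousOn_pi.2 fun i => (hP.smooth_h x hx i).continuousOn
  obtain ⟨D, hD⟩ := (hP.compact_Y.image_of_continuousOn (hh.norm.sup hg.norm)).bddAbove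
  refine tendsto_violation_zero (M := fun k => ‖multiplierVec (μ k) (lam k)‖) (D := D)
    (c := √(p + q)) (C := 2 * (P.f x z + E - F)) hτ hτ1 hα (Real.sqrt_nonneg _) hR.rho_zero
    (monotone_nat_of_le_succ hR.rho_mono) (fun k => norm_nonneg _)
    (fun k => violation_nonneg _ _ _) (fun k => ?_) (fun k => ?_) (fun k => ?_) (fun k => ?_)
    hR.rho_growth
  · exact (violation_le (hρ k) (hμ k) _).trans (hD ⟨_, hR.mem k, rfl⟩)
  · have h1 := (hR.accuracy k z hz.1).trans
      (add_le_add_left (augLag_le_of_mem_feasible v (hρ k) (hμ k) (lam k) hz) _)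
    rw [augLag_eq_add_norm_sq v (hρ k) (hμ k), ← hR.mu_succ, ← hR.lam_succ] at h1
    have h2 : ε k ≤ E := hE ⟨k, rfl⟩
    have h3 : F ≤ P.f x (y (k + 1)) := hF ⟨_, hR.mem k, rfl⟩
    have h4 : 1 / (2 * ρ k) * (‖multiplierVec (μ (k + 1)) (lam (k + 1))‖ ^ 2 -
        ‖multiplierVec (μ k) (lam k)‖ ^ 2) ≤ P.f x z + E - F := by linarith
    have := hρ k
    rw [one_div, inv_mul_le_iff₀ (by positivity)] at h4
    linarith
  · rw [hR.mu_succ, hR.lam_succ]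
    exact norm_multiplierVec_le_add (mul_nonneg (hρ k).le (violation_nonneg _ _ _))
      (abs_updateMu_sub_le v (hρ k) (hμ k) _) (abs_updateLam_sub_le (hρ k) (μ k) (lam k) _)
  · simp only [hR.mu_succ k, hR.lam_succ k]
    exact rho_mul_violation_le v (hρ k) (hμ k) (lam k) _

end IsICNNALMRun

end ParamProblem

/-! ### Nearly stationary points near approximate minimizers -/

theorem hasDerivAt_max_zero_sq (t : ℝ) :
    HasDerivAt (fun t : ℝ => max t 0 ^ 2) (2 * max t 0) t := by
  rcases lt_trichotomy t 0 with h | rfl | h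
  · rw [max_eq_right h.le, mul_zero]
    refine (hasDerivAt_const t (0 : ℝ)).congr_of_eventuallyEq ?_
    filter_upwards [gt_mem_nhds h] with s hs
    simp [max_eq_right (le_of_lt hs)]
  · rw [max_self, mul_zero, hasDerivAt_iff_isLittleO]
    simp only [max_self, ne_eq, OfNat.ofNat_ne_zero, not_false_eq_true, zero_pow, sub_zero,
      smul_zero]
    have h1 : (fun t : ℝ => max t 0 ^ 2) =O[𝓝 0] (fun t : ℝ => t ^ 2) := by
      refine Asymptotics.isBigO_of_le _ fun t => ?_
      rw [norm_pow, norm_pow]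
      refine pow_le_pow_left₀ (norm_nonneg _) ?_ 2
      rw [Real.norm_eq_abs, Real.norm_eq_abs, abs_of_nonneg (le_max_right _ _)]
      exact max_le (le_abs_self t) (abs_nonneg t)
    exact h1.trans_isLittleO (Asymptotics.isLittleO_pow_id one_lt_two)
  · rw [max_eq_left h.le]
    have h1 : HasDerivAt (fun t : ℝ => t ^ 2) (2 * t) t := by simpa using hasDerivAt_pow 2 t
    refine h1.congr_of_eventuallyEq ?_
    filter_upwards [lt_mem_nhds h] with s hs
    rw [max_eq_left (le_of_lt hs)]

/-- `max t 0` is approximated uniformly up to `s` by `(max t 0 ² - max (t - s) 0 ²) / (2 s)`, whose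
derivative is the ramp that vanishes for `t ≤ 0` and equals `1` for `t ≥ s`. -/
theorem abs_smooth_max_sub_le {s : ℝ} (hs : 0 < s) (t : ℝ) :
    |(max t 0 ^ 2 - max (t - s) 0 ^ 2) / (2 * s) - max t 0| ≤ s := by
  rw [div_sub' (by positivity), abs_div, abs_of_pos (show 0 < 2 * s by positivity),
    div_le_iff₀ (by positivity)]
  rcases le_total t 0 with h | h
  · rw [max_eq_right h, max_eq_right (by linarith)]
    simp; positivity
  · rw [max_eq_left h]
    rcases le_total (t - s) 0 with h' | h'
    · rw [max_eq_right h']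
      exact abs_le.2 ⟨by nlinarith, by nlinarith⟩
    · rw [max_eq_left h']
      exact abs_le.2 ⟨by nlinarith, by nlinarith⟩

namespace ParamProblem

variable {d n p q : ℕ} {P : ParamProblem d n p q} {x : EuclideanSpace ℝ (Fin d)}

/-- The gradient of the Lagrangian `f + ∑ μ_j g_j + ∑ lam_i h_i` with respect to `y`. -/
noncomputable def lagrangianGrad (P : ParamProblem d n p q) (x : EuclideanSpace ℝ (Fin d))
    (y : EuclideanSpace ℝ (Fin n)) (μ : Fin p → ℝ) (lam : Fin q → ℝ) :
    EuclideanSpace ℝ (Fin n) :=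
  P.gradF x y + ∑ j, μ j • P.gradG x y j + ∑ i, lam i • P.gradH x y i

/-- If `y` minimizes a smooth penalized objective up to `η`, then an exact minimizer `z` of that
objective plus `κ ‖· - y‖²` is close to `y` and nearly stationary. This replaces
Ekeland's variational principle. -/
theorem Regular.exists_approx_stationary (hP : P.Regular) (hx : x ∈ P.X)
    {φ φ' : Fin p → ℝ → ℝ} (hφ : ∀ j t, HasDerivAt (φ j) (φ' j t) t) {ρ η κ : ℝ}
    (lam : Fin q → ℝ) (hκ : 0 < κ) {y : EuclideanSpace ℝ (Fin n)} (hy : y ∈ P.Y)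
    (hmin : ∀ z ∈ P.Y,
      P.f x y + ∑ j, φ j (P.g x y j) + ∑ i, (lam i * P.h x y i + ρ / 2 * P.h x y i ^ 2) ≤
      P.f x z + ∑ j, φ j (P.g x z j) + ∑ i, (lam i * P.h x z i + ρ / 2 * P.h x z i ^ 2) + η) :
    ∃ z ∈ P.Y, κ * ‖z - y‖ ^ 2 ≤ η ∧ (z ∈ _root_.interior P.Y →
      ‖P.lagrangianGrad x z (fun j => φ' j (P.g x z j)) (P.updateLam x ρ lam z)‖ ^ 2 ≤
        4 * (κ * η)) := by
  set A : EuclideanSpace ℝ (Fin n) → ℝ := fun z =>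
    P.f x z + ∑ j, φ j (P.g x z j) + ∑ i, (lam i * P.h x z i + ρ / 2 * P.h x z i ^ 2) with hA
  have hcont : ContinuousOn (fun z => A z + κ * ‖z - y‖ ^ 2) P.Y := by
    have hf := (hP.smooth_f x hx).continuousOn
    have hg := fun j => (hP.smooth_g x hx j).continuousOn
    have hh := fun i => (hP.smooth_h x hx i).continuousOn
    have hφc : ∀ j, Continuous (φ j) := fun j =>
      continuous_iff_continuousAt.2 fun t => (hφ j t).continuousAt
    have hφg : ∀ j, ContinuousOn (fun z => φ j (P.g x z j)) P.Y := fun j =>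
      (hφc j).comp_continuousOn (hg j)
    simp only [hA]
    fun_prop
  obtain ⟨z, hz, hzmin⟩ := hP.compact_Y.exists_isMinOn ⟨y, hy⟩ hcont
  have hdist : κ * ‖z - y‖ ^ 2 ≤ η := by
    have h1 : A z + κ * ‖z - y‖ ^ 2 ≤ A y + κ * ‖y - y‖ ^ 2 := hzmin hy
    have h2 := hmin z hz
    simp only [sub_self, norm_zero, ne_eq, OfNat.ofNat_ne_zero, not_false_eq_true, zero_pow,
      mul_zero, add_zero] at h1
    linarith
  refine ⟨z, hz, hdist, fun hint => ?_⟩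
  have hnhds : P.Y ∈ 𝓝 z := mem_interior_iff_mem_nhds.1 hint
  have hf : HasFDerivAt (P.f x) (InnerProductSpace.toDual ℝ _ (P.gradF x z)) z :=
    (((hP.smooth_f x hx).contDiffAt hnhds).differentiableAt one_ne_zero).hasGradientAt.hasFDerivAt
  have hg : ∀ j, HasFDerivAt (fun w => P.g x w j)
      (InnerProductSpace.toDual ℝ _ (P.gradG x z j)) z := fun j =>
    (((hP.smooth_g x hx j).contDiffAt hnhds).differentiableAt one_ne_zero).hasGradientAt.hasFDerivAt
  have hh : ∀ i, HasFDerivAt (fun w => P.h x w i)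
      (InnerProductSpace.toDual ℝ _ (P.gradH x z i)) z := fun i =>
    (((hP.smooth_h x hx i).contDiffAt hnhds).differentiableAt one_ne_zero).hasGradientAt.hasFDerivAt
  have hφg : ∀ j, HasFDerivAt (fun w => φ j (P.g x w j))
      (φ' j (P.g x z j) • InnerProductSpace.toDual ℝ _ (P.gradG x z j)) z := fun j =>
    (hφ j _).comp_hasFDerivAt z (hg j)
  have hhh : ∀ i, HasFDerivAt (fun w => lam i * P.h x w i + ρ / 2 * P.h x w i ^ 2)
      (P.updateLam x ρ lam z i • InnerProductSpace.toDual ℝ _ (P.gradH x z i)) z := fun i => by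
    have hd : HasDerivAt (fun t : ℝ => lam i * t + ρ / 2 * t ^ 2) (P.updateLam x ρ lam z i)
        (P.h x z i) := by
      refine (((hasDerivAt_id' (P.h x z i)).const_mul (lam i)).add
        (((hasDerivAt_id' (P.h x z i)).fun_pow 2).const_mul (ρ / 2))).congr_deriv ?_
      simp [updateLam]; ring
    exact hd.comp_hasFDerivAt z (hh i)
  have hsq : HasFDerivAt (fun w => κ * ‖w - y‖ ^ 2)
      (κ • (2 • (innerSL ℝ (z - y)))) z := by
    have h := (hasStrictFDerivAt_norm_sq (z - y)).hasFDerivAt.comp z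
      ((hasFDerivAt_id z).sub_const y)
    exact h.const_mul κ
  have htot := ((hf.add (HasFDerivAt.fun_sum fun j (_ : j ∈ Finset.univ) => hφg j)).add
    (HasFDerivAt.fun_sum fun i (_ : i ∈ Finset.univ) => hhh i)).add hsq
  have h0 := (hzmin.isLocalMin hnhds).hasFDerivAt_eq_zero htot
  have hgrad : P.lagrangianGrad x z (fun j => φ' j (P.g x z j)) (P.updateLam x ρ lam z) =
      -((2 * κ) • (z - y)) := by
    rw [eq_neg_iff_add_eq_zero]
    refine ext_inner_right ℝ fun w => ?_
    have := congrArg (fun T => T w) h0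
    simp only [_root_.add_apply, _root_.smul_apply, _root_.sum_apply,
      InnerProductSpace.toDual_apply_apply, innerSL_apply_apply, _root_.zero_apply, smul_eq_mul,
      nsmul_eq_mul, Nat.cast_ofNat] at this
    simp only [lagrangianGrad, inner_add_left, sum_inner, real_inner_smul_left, inner_zero_left]
    linarith
  rw [hgrad, norm_neg, norm_smul, mul_pow, Real.norm_eq_abs, sq_abs]
  nlinarith

/-- Both augmented Lagrangians are uniform limits of smooth penalized objectives whose derivative
weights `φ' j` satisfy the sign and slackness conditions of the updated multipliers. -/
theorem exists_smooth_penalty (P : ParamProblem d n p q) (x : EuclideanSpace ℝ (Fin d))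
    (v : ALMVariant) {ρ : ℝ} (hρ : 0 < ρ) {μ : Fin p → ℝ} (hμ : ∀ j, 0 ≤ μ j)
    (lam : Fin q → ℝ) {e : ℝ} (he : 0 < e) :
    ∃ φ φ' : Fin p → ℝ → ℝ, (∀ j t, HasDerivAt (φ j) (φ' j t) t) ∧
      (∀ j t, 0 ≤ φ' j t) ∧
      (∀ y j, φ' j (P.g x y j) ≤ P.updateMu x v ρ μ y j) ∧
      (v = .standard → ∀ y j, φ' j (P.g x y j) = P.updateMu x v ρ μ y j) ∧
      (∀ j t, t < 0 → μ j + ρ * t ≤ 0 → φ' j t = 0) ∧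
      ∀ y, |P.f x y + ∑ j, φ j (P.g x y j) +
        ∑ i, (lam i * P.h x y i + ρ / 2 * P.h x y i ^ 2) - P.augLag x v ρ μ lam y| ≤ e := by
  cases v
  · have hS : 0 ≤ ∑ j, μ j := Finset.sum_nonneg fun j _ => hμ j
    obtain ⟨s, hs, hse⟩ : ∃ s > 0, (∑ j, μ j) * s ≤ e := by
      refine ⟨e / (∑ j, μ j + 1), by positivity, ?_⟩
      rw [mul_div_assoc', div_le_iff₀ (by positivity)]
      nlinarith
    refine ⟨fun j t => μ j * ((max t 0 ^ 2 - max (t - s) 0 ^ 2) / (2 * s)) +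
        ρ / 2 * max t 0 ^ 2,
      fun j t => μ j * ((max t 0 - max (t - s) 0) / s) + ρ * max t 0, fun j t => ?_,
      fun j t => ?_, fun y j => ?_, fun h => (by cases h), fun j t ht _ => ?_, fun y => ?_⟩
    · have h1 := hasDerivAt_max_zero_sq t
      have h2 := (hasDerivAt_max_zero_sq (t - s)).comp_sub_const t s
      refine ((((h1.sub h2).div_const (2 * s)).const_mul (μ j)).add
        (h1.const_mul (ρ / 2))).congr_deriv ?_
      field_simp
    · have h1 : max (t - s) 0 ≤ max t 0 := max_le_max_right 0 (by linarith)
      have := hμ j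
      have := le_max_right t 0
      have : 0 ≤ max t 0 - max (t - s) 0 := by linarith
      positivity
    · refine le_max_of_le_left ?_
      have h1 : (max (P.g x y j) 0 - max (P.g x y j - s) 0) / s ≤ 1 := by
        rw [div_le_one hs]
        have h2 := le_max_left (P.g x y j - s) 0
        have h3 := le_max_right (P.g x y j - s) 0
        have : max (P.g x y j) 0 ≤ s + max (P.g x y j - s) 0 := max_le (by linarith) (by linarith)
        linarith
      have := mul_le_mul_of_nonneg_left h1 (hμ j)
      linarith
    · simp only [max_eq_right ht.le, max_eq_right (show t - s ≤ 0 by linarith)]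
      simp
    · have h1 : P.f x y + ∑ j, (μ j * ((max (P.g x y j) 0 ^ 2 - max (P.g x y j - s) 0 ^ 2) /
          (2 * s)) + ρ / 2 * max (P.g x y j) 0 ^ 2) +
          ∑ i, (lam i * P.h x y i + ρ / 2 * P.h x y i ^ 2) - P.augLag x .relu ρ μ lam y =
          ∑ j, μ j * ((max (P.g x y j) 0 ^ 2 - max (P.g x y j - s) 0 ^ 2) / (2 * s) -
            max (P.g x y j) 0) := by
        simp only [augLag, Finset.sum_add_distrib, mul_sub, Finset.sum_sub_distrib,
          ← Finset.mul_sum]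
        ring
      rw [h1]
      refine (Finset.abs_sum_le_sum_abs _ _).trans (le_trans ?_ hse)
      rw [Finset.sum_mul]
      refine Finset.sum_le_sum fun j _ => ?_
      rw [abs_mul, abs_of_nonneg (hμ j)]
      exact mul_le_mul_of_nonneg_left (abs_smooth_max_sub_le hs _) (hμ j)
  · refine ⟨fun j t => 1 / (2 * ρ) * (max (μ j + ρ * t) 0 ^ 2 - μ j ^ 2),
      fun j t => max 0 (μ j + ρ * t), fun j t => ?_, fun j t => le_max_left _ _,
      fun y j => le_rfl, fun _ y j => rfl, fun j t _ h => max_eq_left h, fun y => ?_⟩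
    · have h1 : HasDerivAt (fun t => μ j + ρ * t) ρ t := by
        simpa using ((hasDerivAt_id' t).const_mul ρ).const_add (μ j)
      have h2 := (hasDerivAt_max_zero_sq (μ j + ρ * t)).comp t h1
      refine ((h2.sub_const (μ j ^ 2)).const_mul (1 / (2 * ρ))).congr_deriv ?_
      rw [max_comm]; field_simp
    · refine le_of_eq_of_le ?_ he.le
      rw [abs_eq_zero]
      simp only [augLag, Finset.sum_add_distrib, ← Finset.mul_sum, max_comm (_ + _) (0 : ℝ)]
      ring

/-- One step of the method: a point `y` that minimizes the augmented Lagrangian up to `ε` has a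
nearby point `z` that is nearly stationary for the Lagrangian with multipliers `a` and
`lam + ρ h(z)`. -/
theorem Regular.exists_approx_kkt (hP : P.Regular) (hx : x ∈ P.X) (v : ALMVariant)
    {ρ ε η κ : ℝ} (hρ : 0 < ρ) {μ : Fin p → ℝ} (hμ : ∀ j, 0 ≤ μ j) (lam : Fin q → ℝ)
    (hεη : ε < η) (hκ : 0 < κ) {y : EuclideanSpace ℝ (Fin n)} (hy : y ∈ P.Y)
    (hmin : ∀ z ∈ P.Y, P.augLag x v ρ μ lam y ≤ P.augLag x v ρ μ lam z + ε) :
    ∃ z ∈ P.Y, ∃ a : Fin p → ℝ, κ * ‖z - y‖ ^ 2 ≤ η ∧ (∀ j, 0 ≤ a j) ∧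
      (∀ j, a j ≤ P.updateMu x v ρ μ z j) ∧
      (v = .standard → ∀ j, a j = P.updateMu x v ρ μ z j) ∧
      (∀ j, P.g x z j < 0 → μ j + ρ * P.g x z j ≤ 0 → a j = 0) ∧
      (z ∈ _root_.interior P.Y →
        ‖P.lagrangianGrad x z a (P.updateLam x ρ lam z)‖ ^ 2 ≤ 4 * (κ * η)) := by
  obtain ⟨φ, φ', hφ, h0, hle, hstd, hslack, happ⟩ :=
    exists_smooth_penalty P x v hρ hμ lam (half_pos (sub_pos.2 hεη))
  obtain ⟨z, hz, hd, hgrad⟩ := hP.exists_approx_stationary hx (ρ := ρ) (η := η) hφ lam hκ hy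
    fun z hz => by
      have h1 := (abs_le.1 (happ y)).2
      have h2 := (abs_le.1 (happ z)).1
      have := hmin z hz
      linarith
  exact ⟨z, hz, fun j => φ' j (P.g x z j), hd, fun j => h0 j _, hle z, fun h => hstd h z,
    fun j => hslack j _, hgrad⟩

end ParamProblem

/-! ### Convergence along ultrafilters -/

/-- A sequence is bounded if it converges along every ultrafilter finer than `atTop`. -/
theorem isBounded_range_of_ultrafilter {E : Type*} [SeminormedAddCommGroup E] {u : ℕ → E}
    (h : ∀ U : Ultrafilter ℕ, (U : Filter ℕ) ≤ atTop → ∃ l, Tendsto u U (𝓝 l)) :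
    Bornology.IsBounded (range u) := by
  by_contra hcon
  have hun : ∀ R : ℝ, ∃ᶠ k in atTop, R < ‖u k‖ := by
    intro R hR
    obtain ⟨K, hK⟩ := eventually_atTop.1 hR
    refine hcon ?_
    have hsub : range u ⊆ u '' Iio K ∪ Metric.closedBall 0 R := by
      rintro _ ⟨k, rfl⟩
      rcases lt_or_ge k K with hk | hk
      · exact Or.inl ⟨k, hk, rfl⟩
      · exact Or.inr (by simpa using not_lt.1 (hK k hk))
    exact (((finite_Iio K).image u).isBounded.union Metric.isBounded_closedBall).subset hsub
  have hne : (atTop ⊓ comap (fun k => ‖u k‖) atTop : Filter ℕ).NeBot := by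
    refine ((atTop_basis (α := ℕ)).inf ((atTop_basis_Ioi (α := ℝ)).comap _)).neBot_iff.2 ?_
    rintro ⟨N, R⟩ -
    obtain ⟨k, hk, hkR⟩ := (frequently_atTop.1 (hun R)) N
    exact ⟨k, hk, hkR⟩
  obtain ⟨l, hl⟩ := h (Ultrafilter.of (atTop ⊓ comap (fun k => ‖u k‖) atTop))
    ((Ultrafilter.of_le _).trans inf_le_left)
  have h1 : Tendsto (fun k => ‖u k‖)
      (Ultrafilter.of (atTop ⊓ comap (fun k => ‖u k‖) atTop) : Filter ℕ) atTop :=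
    tendsto_comap.mono_left ((Ultrafilter.of_le _).trans inf_le_right)
  exact not_tendsto_nhds_of_tendsto_atTop h1 _ hl.norm

theorem IsCompact.exists_tendsto_ultrafilter {α X : Type*} [TopologicalSpace X] {s : Set X}
    (hs : IsCompact s) {u : α → X} (U : Ultrafilter α) (hu : ∀ᶠ k in U, u k ∈ s) :
    ∃ l ∈ s, Tendsto u U (𝓝 l) := by
  obtain ⟨l, hl, h⟩ := hs.ultrafilter_le_nhds (U.map u) (le_principal_iff.2 hu)
  exact ⟨l, hl, h⟩

/-- Step `k` of a run produces the iterate with index `k + 1`; the image of an ultrafilter under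
the predecessor map accounts for this shift. -/
theorem tendsto_map_pred_iff {X : Type*} {u : ℕ → X} {U : Ultrafilter ℕ}
    (hU : (U : Filter ℕ) ≤ atTop) {l : Filter X} :
    Tendsto (fun k => u (k + 1)) (U.map Nat.pred) l ↔ Tendsto u U l := by
  rw [Ultrafilter.coe_map, tendsto_map'_iff]
  refine tendsto_congr' ?_
  filter_upwards [hU (eventually_ge_atTop 1)] with k hk
  simp [Nat.sub_add_cancel hk]

theorem map_pred_le_atTop {U : Ultrafilter ℕ} (hU : (U : Filter ℕ) ≤ atTop) :
    ((U.map Nat.pred : Ultrafilter ℕ) : Filter ℕ) ≤ atTop := by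
  rw [Ultrafilter.coe_map]
  exact (map_mono hU).trans (tendsto_sub_atTop_nat 1)

/-! ### Constraint qualifications and limits of approximate KKT points -/

namespace ParamProblem

variable {d n p q : ℕ} {P : ParamProblem d n p q} {x : EuclideanSpace ℝ (Fin d)}

/-- Either constraint qualification makes the gradients of the active constraints positively
linearly independent. -/
theorem Regular.eq_zero_of_sum_eq_zero (hP : P.Regular) (hx : x ∈ P.X)
    {y : EuclideanSpace ℝ (Fin n)} (hy : y ∈ P.feasible x) {a : Fin p → ℝ} {b : Fin q → ℝ}
    (ha : ∀ j, 0 ≤ a j) (hslack : ∀ j, P.g x y j < 0 → a j = 0)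
    (hsum : ∑ j, a j • P.gradG x y j + ∑ i, b i • P.gradH x y i = 0) : a = 0 ∧ b = 0 := by
  rcases hP.cq x hx y hy with ⟨hlin, v, hv, hv'⟩ | hlin
  · have h0 : ∀ j, a j * inner ℝ (P.gradG x y j) v ≤ 0 := fun j => by
      rcases (hy.2.1 j).lt_or_eq with h | h
      · simp [hslack j h]
      · exact mul_nonpos_of_nonneg_of_nonpos (ha j) (hv' j h).le
    have h1 : ∑ j, a j * inner ℝ (P.gradG x y j) v = 0 := by
      have := congrArg (fun w => inner ℝ w v) hsum
      simpa [inner_add_left, sum_inner, real_inner_smul_left, hv] using this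
    have ha0 : a = 0 := by
      funext j
      have h2 := (Finset.sum_eq_zero_iff_of_nonpos fun j _ => h0 j).1 h1 j (Finset.mem_univ j)
      rcases (hy.2.1 j).lt_or_eq with h | h
      · exact hslack j h
      · exact (mul_eq_zero.1 h2).resolve_right (hv' j h).ne
    subst ha0
    refine ⟨rfl, funext fun i => Fintype.linearIndependent_iff.1 hlin b ?_ i⟩
    simpa using hsum
  · classical
    have h1 := Fintype.linearIndependent_iff.1 hlin
      (Sum.elim (fun j : {j : Fin p // P.g x y j = 0} => a j) b) (by
        rw [Fintype.sum_sum_type]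
        simp only [Sum.elim_inl, Sum.elim_inr]
        rw [← hsum]
        congr 1
        rw [← Finset.sum_subtype (Finset.univ.filter fun j => P.g x y j = 0) (by simp)
          (fun j => a j • P.gradG x y j)]
        refine Finset.sum_filter_of_ne fun j _ hj => ?_
        by_contra hne
        exact hj (by rw [hslack j (lt_of_le_of_ne (hy.2.1 j) hne), zero_smul]))
    refine ⟨funext fun j => ?_, funext fun i => h1 (Sum.inr i)⟩
    rcases (hy.2.1 j).lt_or_eq with h | h
    · exact hslack j h
    · exact h1 (Sum.inl ⟨j, h⟩)

theorem Regular.continuousAt_gradF (hP : P.Regular) (hx : x ∈ P.X)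
    {y : EuclideanSpace ℝ (Fin n)} (hy : P.Y ∈ 𝓝 y) : ContinuousAt (P.gradF x) y :=
  (InnerProductSpace.toDual ℝ _).symm.continuous.continuousAt.comp
    (((hP.smooth_f x hx).contDiffAt hy).fderiv_right (m := 0) (by simp)).continuousAt

theorem Regular.continuousAt_gradG (hP : P.Regular) (hx : x ∈ P.X)
    {y : EuclideanSpace ℝ (Fin n)} (hy : P.Y ∈ 𝓝 y) (j : Fin p) :
    ContinuousAt (fun z => P.gradG x z j) y :=
  (InnerProductSpace.toDual ℝ _).symm.continuous.continuousAt.comp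
    (((hP.smooth_g x hx j).contDiffAt hy).fderiv_right (m := 0) (by simp)).continuousAt

theorem Regular.continuousAt_gradH (hP : P.Regular) (hx : x ∈ P.X)
    {y : EuclideanSpace ℝ (Fin n)} (hy : P.Y ∈ 𝓝 y) (i : Fin q) :
    ContinuousAt (fun z => P.gradH x z i) y :=
  (InnerProductSpace.toDual ℝ _).symm.continuous.continuousAt.comp
    (((hP.smooth_h x hx i).contDiffAt hy).fderiv_right (m := 0) (by simp)).continuousAt

/-- Approximate KKT points that converge to a feasible point have convergent multipliers along every
ultrafilter, with a KKT triple as the limit: if the multipliers were unbounded, their normalizations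
would converge to a nontrivial positive linear relation between the active gradients. -/
theorem Regular.exists_tendsto_isKKTTriple (hP : P.Regular) (hx : x ∈ P.X) {ι : Type*}
    {V : Ultrafilter ι} {y : EuclideanSpace ℝ (Fin n)} (hy : y ∈ P.feasible x)
    {z : ι → EuclideanSpace ℝ (Fin n)} {a : ι → Fin p → ℝ} {b : ι → Fin q → ℝ}
    (hz : Tendsto z V (𝓝 y)) (ha : ∀ k j, 0 ≤ a k j)
    (hslack : ∀ j, P.g x y j < 0 → ∀ᶠ k in V, a k j = 0)
    (hgrad : Tendsto (fun k => P.lagrangianGrad x (z k) (a k) (b k)) V (𝓝 0)) :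
    ∃ a' b', Tendsto a V (𝓝 a') ∧ Tendsto b V (𝓝 b') ∧ P.IsKKTTriple x y a' b' := by
  have hY : P.Y ∈ 𝓝 y := mem_interior_iff_mem_nhds.1 (hP.interior x hx hy)
  have hF := (hP.continuousAt_gradF hx hY).tendsto.comp hz
  have hG := fun j => (hP.continuousAt_gradG hx hY j).tendsto.comp hz
  have hH := fun i => (hP.continuousAt_gradH hx hY i).tendsto.comp hz
  have hsumlim : ∀ {α : ι → Fin p → ℝ} {β : ι → Fin q → ℝ} {α' : Fin p → ℝ} {β' : Fin q → ℝ},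
      Tendsto α V (𝓝 α') → Tendsto β V (𝓝 β') →
      Tendsto (fun k => ∑ j, α k j • P.gradG x (z k) j + ∑ i, β k i • P.gradH x (z k) i) V
        (𝓝 (∑ j, α' j • P.gradG x y j + ∑ i, β' i • P.gradH x y i)) := fun hα hβ =>
    (tendsto_finsetSum _ fun j _ => (tendsto_pi_nhds.1 hα j).smul (hG j)).add
      (tendsto_finsetSum _ fun i _ => (tendsto_pi_nhds.1 hβ i).smul (hH i))
  by_cases hB : ∃ R : ℝ, ∀ᶠ k in V, ‖(a k, b k)‖ ≤ R
  · obtain ⟨R, hR⟩ := hB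
    obtain ⟨⟨a', b'⟩, -, hlim⟩ := (isCompact_closedBall (0 : (Fin p → ℝ) × (Fin q → ℝ)) R)
      |>.exists_tendsto_ultrafilter V (u := fun k => (a k, b k)) (by simpa using hR)
    have ha' : Tendsto a V (𝓝 a') := (continuous_fst.tendsto _).comp hlim
    have hb' : Tendsto b V (𝓝 b') := (continuous_snd.tendsto _).comp hlim
    refine ⟨a', b', ha', hb', hy,
      fun j => ge_of_tendsto' (tendsto_pi_nhds.1 ha' j) fun k => ha k j, fun j => ?_, ?_⟩
    · rcases (hy.2.1 j).lt_or_eq with h | h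
      · have h0 : Tendsto (fun k => a k j) V (𝓝 0) :=
          tendsto_const_nhds.congr' ((hslack j h).mono fun k hk => hk.symm)
        rw [tendsto_nhds_unique (tendsto_pi_nhds.1 ha' j) h0, zero_mul]
      · rw [h, mul_zero]
    · refine tendsto_nhds_unique ?_ hgrad
      simp only [lagrangianGrad, add_assoc]
      exact hF.add (hsumlim ha' hb')
  · exfalso
    have htop : Tendsto (fun k => ‖(a k, b k)‖) V atTop := by
      refine tendsto_atTop.2 fun R => ?_
      have h1 : ∀ᶠ k in V, ¬ ‖(a k, b k)‖ ≤ R :=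
        Ultrafilter.eventually_not.2 fun h => hB ⟨R, h⟩
      exact h1.mono fun k hk => (not_le.1 hk).le
    set t : ι → ℝ := fun k => ‖(a k, b k)‖⁻¹ with ht
    have ht0 : Tendsto t V (𝓝 0) := htop.inv_tendsto_atTop
    have hone : ∀ᶠ k in V, ‖t k • (a k, b k)‖ = 1 := by
      filter_upwards [htop.eventually_gt_atTop 0] with k hk
      rw [norm_smul, ht, norm_inv, norm_norm, inv_mul_cancel₀ hk.ne']
    obtain ⟨⟨a', b'⟩, -, hlim⟩ := (isCompact_closedBall (0 : (Fin p → ℝ) × (Fin q → ℝ)) 1)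
      |>.exists_tendsto_ultrafilter V (u := fun k => t k • (a k, b k))
        (hone.mono fun k hk => by rw [mem_closedBall_zero_iff, hk])
    have ha' : Tendsto (fun k => t k • a k) V (𝓝 a') := (continuous_fst.tendsto _).comp hlim
    have hb' : Tendsto (fun k => t k • b k) V (𝓝 b') := (continuous_snd.tendsto _).comp hlim
    have hnorm : ‖(a', b')‖ = 1 := tendsto_nhds_unique hlim.norm
      (tendsto_const_nhds.congr' (hone.mono fun k hk => hk.symm))
    have hzero : ∑ j, a' j • P.gradG x y j + ∑ i, b' i • P.gradH x y i = 0 := by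
      refine tendsto_nhds_unique (hsumlim ha' hb') ?_
      have h1 := (ht0.smul hgrad).sub (ht0.smul hF)
      rw [smul_zero, zero_smul, sub_zero] at h1
      refine h1.congr fun k => ?_
      simp only [lagrangianGrad, Function.comp_apply, smul_add, Finset.smul_sum, Pi.smul_apply,
        smul_eq_mul, mul_smul]
      abel
    obtain ⟨rfl, rfl⟩ := hP.eq_zero_of_sum_eq_zero hx hy
      (fun j => ge_of_tendsto' (tendsto_pi_nhds.1 ha' j) fun k =>
        mul_nonneg (inv_nonneg.2 (norm_nonneg _)) (ha k j))
      (fun j hj => tendsto_nhds_unique (tendsto_pi_nhds.1 ha' j)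
        (tendsto_const_nhds.congr' ((hslack j hj).mono fun k hk => by simp [hk]))) hzero
    rw [show ((0 : Fin p → ℝ), (0 : Fin q → ℝ)) = 0 from rfl, norm_zero] at hnorm
    exact zero_ne_one hnorm

end ParamProblem

/-! ### Limits of the iterates and of the multipliers -/

namespace ParamProblem

variable {d n p q : ℕ} {P : ParamProblem d n p q} {x : EuclideanSpace ℝ (Fin d)}

theorem abs_updateMu_sub_updateMu_le (v : ALMVariant) (ρ : ℝ) (μ : Fin p → ℝ)
    (y z : EuclideanSpace ℝ (Fin n)) (j : Fin p) :
    |P.updateMu x v ρ μ z j - P.updateMu x v ρ μ y j| ≤ |ρ * (P.g x z j - P.g x y j)| := by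
  cases v
  · refine (abs_max_sub_max_le_abs _ _ _).trans ?_
    rw [add_sub_add_left_eq_sub, ← mul_sub, abs_mul, abs_mul]
    exact mul_le_mul_of_nonneg_left (abs_max_sub_max_le_abs _ _ _) (abs_nonneg _)
  · simp only [updateMu, max_comm (0 : ℝ)]
    refine (abs_max_sub_max_le_abs _ _ _).trans ?_
    rw [add_sub_add_left_eq_sub, ← mul_sub]

/-- Limits of points with vanishing violation are feasible. -/
theorem Regular.mem_feasible_of_tendsto (hP : P.Regular) (hx : x ∈ P.X) {ι : Type*}
    {F : Filter ι} [F.NeBot] {u : ι → EuclideanSpace ℝ (Fin n)} {ybar : EuclideanSpace ℝ (Fin n)}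
    {ρ : ι → ℝ} {μ : ι → Fin p → ℝ} (hu : ∀ k, u k ∈ P.Y) (hlim : Tendsto u F (𝓝 ybar))
    (hν : Tendsto (fun k => P.violation x (ρ k) (μ k) (u k)) F (𝓝 0)) :
    ybar ∈ P.feasible x := by
  have hY : ybar ∈ P.Y := hP.compact_Y.isClosed.mem_of_tendsto hlim (.of_forall hu)
  have hlim' : Tendsto u F (𝓝[P.Y] ybar) :=
    tendsto_nhdsWithin_iff.2 ⟨hlim, .of_forall hu⟩
  refine ⟨hY, fun j => ?_, fun i => ?_⟩
  · exact le_of_tendsto_of_tendsto' (((hP.smooth_g x hx j).continuousOn _ hY).tendsto.comp hlim')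
      hν fun k => ((le_max_left _ _).trans (le_abs_self _)).trans (abs_max_le_violation _ _ _ j)
  · exact tendsto_nhds_unique (((hP.smooth_h x hx i).continuousOn _ hY).tendsto.comp hlim')
      (squeeze_zero_norm (fun k => abs_h_le_violation _ _ _ i) hν)

namespace IsICNNALMRun

variable {v : ALMVariant} {τ α : ℝ} {ε : ℕ → ℝ} {θ : ℕ → ICNN n}
  {y : ℕ → EuclideanSpace ℝ (Fin n)} {μ : ℕ → Fin p → ℝ} {lam : ℕ → Fin q → ℝ} {ρ : ℕ → ℝ}

theorem epsilon_nonneg (hR : P.IsICNNALMRun x v τ α ε θ y μ lam ρ) (k : ℕ) : 0 ≤ ε k := by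
  have := hR.accuracy k _ (hR.mem k)
  linarith

/-- Along an ultrafilter on which the iterates converge there are approximate KKT points near the
iterates whose multipliers converge, and the limit is a KKT triple.  The weights `κ` trade the
distance to the iterates for the size of the residual. -/
theorem exists_tendsto_isKKTTriple (hP : P.Regular) (hx : x ∈ P.X)
    (hR : P.IsICNNALMRun x v τ α ε θ y μ lam ρ)
    {V : Ultrafilter ℕ}
    (hν : Tendsto (fun k => P.violation x (ρ k) (μ k) (y (k + 1))) V (𝓝 0))
    {ybar : EuclideanSpace ℝ (Fin n)} (hy : Tendsto (fun k => y (k + 1)) V (𝓝 ybar))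
    {κ η : ℕ → ℝ} (hκ : ∀ k, 0 < κ k) (hη : ∀ k, ε k < η k)
    (hηκ : Tendsto (fun k => η k / κ k) V (𝓝 0)) (hκη : Tendsto (fun k => κ k * η k) V (𝓝 0)) :
    ∃ (z : ℕ → EuclideanSpace ℝ (Fin n)) (a : ℕ → Fin p → ℝ) (a' : Fin p → ℝ) (b' : Fin q → ℝ),
      (∀ k, κ k * ‖z k - y (k + 1)‖ ^ 2 ≤ η k) ∧ Tendsto z V (𝓝 ybar) ∧
      (∀ k j, a k j ≤ P.updateMu x v (ρ k) (μ k) (z k) j) ∧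
      (v = .standard → ∀ k j, a k j = P.updateMu x v (ρ k) (μ k) (z k) j) ∧
      Tendsto a V (𝓝 a') ∧
      Tendsto (fun k => P.updateLam x (ρ k) (lam k) (z k)) V (𝓝 b') ∧
      P.IsKKTTriple x ybar a' b' := by
  have hfeas := hP.mem_feasible_of_tendsto hx hR.mem hy hν
  have hint := hP.interior x hx hfeas
  have hnhds : P.Y ∈ 𝓝 ybar := mem_interior_iff_mem_nhds.1 hint
  choose z _ a hzy ha0 hale hastd haslack hgrad using fun k =>
    hP.exists_approx_kkt hx v (hR.rho_pos k) (hR.mu_nonneg k) (lam k) (hη k) (hκ k) (hR.mem k)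
      (hR.accuracy k)
  have hdiff : Tendsto (fun k => z k - y (k + 1)) V (𝓝 0) := by
    have h1 := hηκ.sqrt
    rw [Real.sqrt_zero] at h1
    refine squeeze_zero_norm (fun k => Real.le_sqrt_of_sq_le ?_) h1
    rw [le_div_iff₀' (hκ k)]
    exact hzy k
  have hz : Tendsto z V (𝓝 ybar) := by
    simpa using hdiff.add hy
  have hG : ∀ j, ContinuousAt (fun w => P.g x w j) ybar := fun j =>
    ((hP.smooth_g x hx j).contDiffAt hnhds).continuousAt
  have hgrad0 : Tendsto (fun k => P.lagrangianGrad x (z k) (a k)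
      (P.updateLam x (ρ k) (lam k) (z k))) V (𝓝 0) := by
    have h1 := (hκη.const_mul 4).sqrt
    rw [mul_zero, Real.sqrt_zero] at h1
    refine squeeze_zero_norm' ?_ h1
    filter_upwards [hz.eventually (isOpen_interior.mem_nhds hint)] with k hk
    exact Real.le_sqrt_of_sq_le (hgrad k hk)
  have hslack : ∀ j, P.g x ybar j < 0 → ∀ᶠ k in V, a k j = 0 := by
    intro j hj
    have hδ : P.g x ybar j < P.g x ybar j / 2 := by linarith
    filter_upwards [((hG j).tendsto.comp hz).eventually (gt_mem_nhds hδ),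
      ((hG j).tendsto.comp hy).eventually (gt_mem_nhds hδ),
      hν.eventually (gt_mem_nhds (show 0 < -(P.g x ybar j / 2) by linarith))] with k h1 h2 h3
    simp only [Function.comp_apply] at h1 h2
    have hρ := hR.rho_pos k
    have h4 := (abs_lt.1
      ((abs_max_le_violation (P := P) (x := x) (ρ k) (μ k) (y (k + 1)) j).trans_lt h3)).1
    rw [neg_neg] at h4
    have h5 : P.g x ybar j / 2 < -(μ k j) / ρ k := (lt_max_iff.1 h4).resolve_left h2.not_gt
    rw [lt_div_iff₀ hρ] at h5
    refine haslack k j (by linarith) ?_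
    nlinarith
  obtain ⟨a', b', ha', hb', hkkt⟩ :=
    hP.exists_tendsto_isKKTTriple hx hfeas hz ha0 hslack hgrad0
  exact ⟨z, a, a', b', hzy, hz, hale, fun hv k => hastd k hv, ha', hb', hkkt⟩

/-- The limit of the iterates along an ultrafilter is a KKT point. -/
theorem isKKTPoint_of_tendsto (hP : P.Regular) (hx : x ∈ P.X) (hτ : 0 < τ) (hτ1 : τ < 1)
    (hα : 1 < α) (hR : P.IsICNNALMRun x v τ α ε θ y μ lam ρ) (hε : Tendsto ε atTop (𝓝 0))
    {U : Ultrafilter ℕ} (hU : (U : Filter ℕ) ≤ atTop) {ybar : EuclideanSpace ℝ (Fin n)}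
    (hy : Tendsto y U (𝓝 ybar)) : P.IsKKTPoint x ybar := by
  have hη : Tendsto (fun k : ℕ => ε k + 1 / ((k : ℝ) + 1)) atTop (𝓝 0) := by
    simpa using hε.add tendsto_one_div_add_atTop_nhds_zero_nat
  have hV := map_pred_le_atTop hU
  obtain ⟨-, -, a', b', -, -, -, -, -, -, hkkt⟩ :=
    hR.exists_tendsto_isKKTTriple hP hx ((hR.tendsto_violation hP hx hτ hτ1 hα hε).mono_left hV)
      ((tendsto_map_pred_iff hU).2 hy) (κ := fun _ => 1)
      (η := fun k => ε k + 1 / ((k : ℝ) + 1)) (fun _ => one_pos)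
      (fun k => lt_add_of_pos_right _ (by positivity))
      (by simpa only [div_one] using hη.mono_left hV)
      (by simpa only [one_mul] using hη.mono_left hV)
  exact ⟨a', b', hkkt⟩

/-- With the accuracy `ρ ε → 0`, the multipliers of the approximate KKT points differ from the
updated multipliers of the method by a null sequence, up to the freedom that the `relu` variant
leaves at the kink. -/
theorem exists_multiplier_limits (hP : P.Regular) (hx : x ∈ P.X) (hτ : 0 < τ) (hτ1 : τ < 1)
    (hα : 1 < α) (hR : P.IsICNNALMRun x v τ α ε θ y μ lam ρ) (hε : Tendsto ε atTop (𝓝 0))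
    (hρε : Tendsto (fun k => ρ k * ε k) atTop (𝓝 0))
    {U : Ultrafilter ℕ} (hU : (U : Filter ℕ) ≤ atTop) {ybar : EuclideanSpace ℝ (Fin n)}
    (hy : Tendsto y U (𝓝 ybar)) :
    ∃ a' b', P.IsKKTTriple x ybar a' b' ∧ Tendsto lam U (𝓝 b') ∧
      (v = .standard → Tendsto μ U (𝓝 a')) ∧
      ∀ mubar, Tendsto μ U (𝓝 mubar) → ∀ j, a' j ≤ mubar j := by
  have hρ := hR.rho_pos
  set η : ℕ → ℝ := fun k => ε k + 1 / (ρ k * ((k : ℝ) + 1)) with hηdef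
  have hη : ∀ k, ε k < η k := fun k => by
    have := hρ k
    exact lt_add_of_pos_right _ (by positivity)
  have hρη : Tendsto (fun k => ρ k * η k) atTop (𝓝 0) := by
    have h := hρε.add tendsto_one_div_add_atTop_nhds_zero_nat
    rw [add_zero] at h
    refine h.congr fun k => ?_
    have := (hρ k).ne'
    simp only [hηdef]; field_simp
  have hηρ : Tendsto (fun k => η k / ρ k) atTop (𝓝 0) := by
    have h := hρη.div_const (ρ 0 ^ 2)
    rw [zero_div] at h
    refine squeeze_zero (fun k => ?_) (fun k => ?_) h
    · exact div_nonneg ((hR.epsilon_nonneg k).trans (hη k).le) (hρ k).le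
    · have h0 : 0 ≤ η k := (hR.epsilon_nonneg k).trans (hη k).le
      have h1 : ρ 0 ^ 2 ≤ ρ k ^ 2 := pow_le_pow_left₀ hR.rho_zero.le (hR.rho_zero_le k) 2
      rw [div_le_div_iff₀ (hρ k) (pow_pos hR.rho_zero 2)]
      have := mul_le_mul_of_nonneg_left h1 h0
      linarith
  have hV := map_pred_le_atTop hU
  have hyV := (tendsto_map_pred_iff hU).2 hy
  obtain ⟨z, a, a', b', hzy, hz, hale, hastd, ha', hb', hkkt⟩ :=
    hR.exists_tendsto_isKKTTriple hP hx ((hR.tendsto_violation hP hx hτ hτ1 hα hε).mono_left hV)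
      hyV hρ hη (hηρ.mono_left hV) (hρη.mono_left hV)
  have hnhds : P.Y ∈ 𝓝 ybar := mem_interior_iff_mem_nhds.1 (hP.interior x hx hkkt.primal)
  -- `(ρ ‖z - y‖)² ≤ ρ η`, and the constraint functions are Lipschitz near the limit
  have hlip : ∀ F : EuclideanSpace ℝ (Fin n) → ℝ, ContDiffOn ℝ 1 F P.Y →
      Tendsto (fun k => ρ k * (F (z k) - F (y (k + 1)))) (U.map Nat.pred) (𝓝 0) := by
    intro F hF
    obtain ⟨K, t, ht, hK⟩ := (hF.contDiffAt hnhds).exists_lipschitzOnWith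
    have h1 := ((hρη.mono_left hV).sqrt).const_mul (K : ℝ)
    rw [Real.sqrt_zero, mul_zero] at h1
    refine squeeze_zero_norm' ?_ h1
    filter_upwards [hz.eventually ht, hyV.eventually ht] with k h2 h3
    have h4 := hK.dist_le_mul _ h2 _ h3
    rw [dist_eq_norm, dist_eq_norm] at h4
    have h5 : ρ k * ‖z k - y (k + 1)‖ ≤ √(ρ k * η k) := by
      refine Real.le_sqrt_of_sq_le ?_
      have := mul_le_mul_of_nonneg_left (hzy k) (hρ k).le
      linarith
    rw [norm_mul, Real.norm_of_nonneg (hρ k).le]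
    calc ρ k * ‖F (z k) - F (y (k + 1))‖ ≤ ρ k * (K * ‖z k - y (k + 1)‖) :=
          mul_le_mul_of_nonneg_left h4 (hρ k).le
      _ = K * (ρ k * ‖z k - y (k + 1)‖) := by ring
      _ ≤ K * √(ρ k * η k) := mul_le_mul_of_nonneg_left h5 K.2
  have hmu : ∀ j, Tendsto (fun k => P.updateMu x v (ρ k) (μ k) (z k) j - μ (k + 1) j)
      (U.map Nat.pred) (𝓝 0) := fun j => by
    have h1 := (hlip _ (hP.smooth_g x hx j)).abs
    rw [abs_zero] at h1
    refine squeeze_zero_norm (fun k => ?_) h1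
    rw [hR.mu_succ]
    exact abs_updateMu_sub_updateMu_le v _ _ _ _ j
  refine ⟨a', b', hkkt, (tendsto_map_pred_iff hU).1 ?_, fun hv => (tendsto_map_pred_iff hU).1 ?_,
    fun mubar hmubar j => ?_⟩
  · refine tendsto_pi_nhds.2 fun i => ?_
    have h1 := (tendsto_pi_nhds.1 hb' i).sub (hlip _ (hP.smooth_h x hx i))
    rw [sub_zero] at h1
    refine h1.congr fun k => ?_
    rw [hR.lam_succ]
    simp only [updateLam]; ring
  · refine tendsto_pi_nhds.2 fun j => ?_
    have h1 := (tendsto_pi_nhds.1 ha' j).sub (hmu j)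
    rw [sub_zero] at h1
    refine h1.congr fun k => ?_
    rw [hastd hv]; ring
  · have h1 := (hmu j).add (tendsto_pi_nhds.1 ((tendsto_map_pred_iff hU).2 hmubar) j)
    rw [zero_add] at h1
    exact le_of_tendsto_of_tendsto' (tendsto_pi_nhds.1 ha' j) h1 fun k => by
      rw [sub_add_cancel]; exact hale k j

end IsICNNALMRun

end ParamProblem

theorem mainTheorem1 {d n p q : ℕ} (P : ParamProblem d n p q) (hP : P.Regular)
    (x : EuclideanSpace ℝ (Fin d)) (hx : x ∈ P.X) :
    (∀ (v : ALMVariant) (ρ : ℝ) (μ : Fin p → ℝ) (lam : Fin q → ℝ) (ε : ℝ),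
      0 < ρ → (∀ j, 0 ≤ μ j) → 0 < ε →
      ∃ θ : ICNN n, (∃ y ∈ P.Y, IsMinOn θ.eval P.Y y) ∧
        ∀ y ∈ P.Y, IsMinOn θ.eval P.Y y →
          ∀ z ∈ P.Y, P.augLag x v ρ μ lam y ≤ P.augLag x v ρ μ lam z + ε) ∧
    (∀ (v : ALMVariant) (τ α : ℝ) (ε : ℕ → ℝ) (θ : ℕ → ICNN n)
      (y : ℕ → EuclideanSpace ℝ (Fin n)) (μ : ℕ → Fin p → ℝ) (lam : ℕ → Fin q → ℝ) (ρ : ℕ → ℝ),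
      0 < τ → τ < 1 → 1 < α →
      P.IsICNNALMRun x v τ α ε θ y μ lam ρ →
      Tendsto ε atTop (𝓝 0) →
      (∃ ybar, MapClusterPt ybar atTop y) ∧
      (∀ ybar, MapClusterPt ybar atTop y → P.IsKKTPoint x ybar) ∧
      Tendsto (fun k => Metric.infDist (y k) {z | P.IsKKTPoint x z}) atTop (𝓝 0) ∧
      (Tendsto (fun k => ρ k * ε k) atTop (𝓝 0) →
        (v = ALMVariant.standard →
          Bornology.IsBounded (range fun k => (μ k, lam k)) ∧
          ∀ ybar mubar lambar,
            MapClusterPt (ybar, mubar, lambar) atTop (fun k => (y k, μ k, lam k)) →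
            P.IsKKTTriple x ybar mubar lambar) ∧
        (v = ALMVariant.relu →
          ∀ ybar mubar lambar,
            MapClusterPt (ybar, mubar, lambar) atTop (fun k => (y k, μ k, lam k)) →
            ∃ mu' : Fin p → ℝ, (∀ j, mu' j ≤ mubar j) ∧
              P.IsKKTTriple x ybar mu' lambar))) := by
  refine ⟨fun v ρ μ lam ε _ _ hε => ?_, fun v τ α ε θ y μ lam ρ hτ hτ1 hα hR hε => ?_⟩
  · obtain ⟨w, hw⟩ := hP.nonempty x hx
    obtain ⟨y₀, hy₀, hmin⟩ :=
      hP.compact_Y.exists_isMinOn ⟨w, hw.1⟩ (hP.continuousOn_augLag hx v ρ μ lam)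
    obtain ⟨θ, hθ, hθmin⟩ := ICNN.exists_isMinOn_imp hy₀ hmin
    exact ⟨θ, hθ, fun y hy hmy z hz => (hθmin y hy hmy hz).trans (by linarith)⟩
  · have hconv : ∀ U : Ultrafilter ℕ, (U : Filter ℕ) ≤ atTop → ∃ ybar, Tendsto y U (𝓝 ybar) := by
      intro U hU
      obtain ⟨l, -, hl⟩ := hP.compact_Y.exists_tendsto_ultrafilter U (u := y) (by
        filter_upwards [hU (eventually_ge_atTop 1)] with k hk
        have := hR.mem (k - 1)
        rwa [Nat.sub_add_cancel hk] at this)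
      exact ⟨l, hl⟩
    refine ⟨?_, fun ybar hybar => ?_, ?_, fun hρε => ⟨fun hv => ⟨?_, ?_⟩, fun _ => ?_⟩⟩
    · obtain ⟨l, hl⟩ := hconv (hyperfilter ℕ) (Nat.hyperfilter_le_atTop)
      exact ⟨l, mapClusterPt_iff_ultrafilter.2 ⟨_, Nat.hyperfilter_le_atTop, hl⟩⟩
    · obtain ⟨U, hU, hlim⟩ := mapClusterPt_iff_ultrafilter.1 hybar
      exact hR.isKKTPoint_of_tendsto hP hx hτ hτ1 hα hε hU hlim
    · refine (tendsto_iff_ultrafilter _ _ _).2 fun U hU => ?_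
      obtain ⟨l, hl⟩ := hconv U hU
      have hkkt := hR.isKKTPoint_of_tendsto hP hx hτ hτ1 hα hε hU hl
      exact squeeze_zero (fun k => Metric.infDist_nonneg)
        (fun k => Metric.infDist_le_dist_of_mem hkkt) (tendsto_iff_dist_tendsto_zero.1 hl)
    · refine isBounded_range_of_ultrafilter fun U hU => ?_
      obtain ⟨l, hl⟩ := hconv U hU
      obtain ⟨a, b, -, hb, ha, -⟩ :=
        hR.exists_multiplier_limits hP hx hτ hτ1 hα hε hρε hU hl
      exact ⟨(a, b), (ha hv).prodMk_nhds hb⟩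
    · intro ybar mubar lambar hcl
      obtain ⟨U, hU, hlim⟩ := mapClusterPt_iff_ultrafilter.1 hcl
      obtain ⟨a, b, hkkt, hb, ha, -⟩ := hR.exists_multiplier_limits hP hx hτ hτ1 hα hε hρε hU
        ((continuous_fst.tendsto _).comp hlim)
      have hmu : Tendsto μ U (𝓝 mubar) := (continuous_snd.fst.tendsto _).comp hlim
      have hlam : Tendsto lam U (𝓝 lambar) := (continuous_snd.snd.tendsto _).comp hlim
      rw [tendsto_nhds_unique hlam hb, tendsto_nhds_unique hmu (ha hv)]
      exact hkkt
    · intro ybar mubar lambar hcl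
      obtain ⟨U, hU, hlim⟩ := mapClusterPt_iff_ultrafilter.1 hcl
      obtain ⟨a, b, hkkt, hb, -, hle⟩ := hR.exists_multiplier_limits hP hx hτ hτ1 hα hε hρε hU
        ((continuous_fst.tendsto _).comp hlim)
      have hlam : Tendsto lam U (𝓝 lambar) := (continuous_snd.snd.tendsto _).comp hlim
      rw [tendsto_nhds_unique hlam hb]
      exact ⟨a, hle _ ((continuous_snd.fst.tendsto _).comp hlim), hkkt⟩
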